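/- For an integer $k\ge 1$ let $B_k$ be the braid group on $k$ strands, with standard generators $a_1,\dots,a_{k-1}$ and relations $a_ia_{i+1}a_i=a_{i+1}a_ia_{i+1}$ and $a_ia_j=a_ja_i$ for $|i-j|\ge 2$. A braid is positive if it is a product of the generators $a_i$. The closure of a $k$-braid is regarded as an oriented link in $S^3$, up to isotopy. For positive integers $p,q$, the torus link $T_{p,q}$ is the closure of the $p$-braid $(a_1a_2\cdots a_{p-1})^q$. Deleting a generator in a positive braid $\beta$ means removing one letter $a_i$ from a positive braid word that represents $\beta$. A link $K$ is subword-adjacent to a link $T$ if, for some $k$, there are positive $k$-braids $\beta_1$ and $\beta_2$ with closures $K$ and $T$, respectively, such that $\beta_1$ can be obtained from $\beta_2$ by successively deleting generators. **Proposition.** Let $n$ and $m$ be positive integers. If $n\le \frac{5m-3}{2}$, then the torus link $T_{2,n}$ is subword-adjacent to the torus link $T_{4,m}$. -/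

import Mathlib

open scoped ContDiff

noncomputable section

namespace BraidLink

/-! ### Oriented links in the 3-sphere and isotopy

The 3-sphere is the unit sphere `|x|² + |y|² = 1` of `ℂ²`. -/

/-- `γ` is a smooth embedding into the 3-sphere of the closed oriented 1-manifold
`(Fin n × ℝ) / ((i, t + 1) ∼ (π i, t))`, which is a disjoint union of circles, one for each
cycle of the permutation `π`. (Every closed oriented 1-manifold is of this form; a disjoint union
of `n` circles `ℝ/ℤ` is the case `π = 1`.) The last field says both that `γ` descends to this
quotient and that it is injective on it. -/
structure IsEmbedded {n : ℕ} (π : Equiv.Perm (Fin n)) (γ : Fin n → ℝ → ℂ × ℂ) : Prop where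
  smooth : ∀ i, ContDiff ℝ ∞ (γ i)
  mem_sphere : ∀ i t, Complex.normSq (γ i t).1 + Complex.normSq (γ i t).2 = 1
  immersion : ∀ i t, deriv (γ i) t ≠ 0
  eq_iff : ∀ i j s t, γ i s = γ j t ↔ ∃ k : ℤ, s = t + k ∧ (π ^ k) i = j

/-- An oriented (smooth) link in the 3-sphere, given by a parametrization. -/
structure OrientedLink where
  n : ℕ
  perm : Equiv.Perm (Fin n)
  curve : Fin n → ℝ → ℂ × ℂ
  embedded : IsEmbedded perm curve

/-- Two parametrizations trace out the same oriented submanifold: they have the same image, and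
at a common point their velocities point in the same direction. -/
def SameOriented {n n' : ℕ} (γ : Fin n → ℝ → ℂ × ℂ) (γ' : Fin n' → ℝ → ℂ × ℂ) : Prop :=
  (⋃ i, Set.range (γ i)) = (⋃ i, Set.range (γ' i)) ∧
  ∀ i j s t, γ i s = γ' j t → ∃ c : ℝ, 0 < c ∧ deriv (γ' j) t = c • deriv (γ i) s

/-- There is a smooth isotopy through embeddings, `F τ` for `τ ∈ [0, 1]`, such that `F 0`
parametrizes the oriented link `K` and `F 1` parametrizes the oriented link `L`. -/
def SmoothIsotopy (K L : OrientedLink) : Prop :=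
  ∃ (n : ℕ) (π : Equiv.Perm (Fin n)) (F : ℝ → Fin n → ℝ → ℂ × ℂ),
    (∀ i, ContDiff ℝ ∞ (fun x : ℝ × ℝ => F x.1 i x.2)) ∧
    (∀ τ ∈ Set.Icc (0 : ℝ) 1, IsEmbedded π (F τ)) ∧
    SameOriented K.curve (F 0) ∧ SameOriented (F 1) L.curve

/-- Two oriented links are isotopic, that is, they are the same link up to isotopy: the
equivalence relation generated by smooth isotopies. (Smooth isotopy of links is itself an
equivalence relation.) -/
def Isotopic : OrientedLink → OrientedLink → Prop :=
  Relation.EqvGen SmoothIsotopy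

/-! ### The braid group and positive braids -/

/-- The relators of Artin's presentation of the braid group on `n` strands; the generator
`a_{i+1}` is indexed by `i : Fin (n - 1)`. -/
def braidRels (n : ℕ) : Set (FreeGroup (Fin (n - 1))) :=
  {r | ∃ i j : Fin (n - 1), (i : ℕ) + 1 = j ∧
      r = FreeGroup.of i * FreeGroup.of j * FreeGroup.of i *
        (FreeGroup.of j * FreeGroup.of i * FreeGroup.of j)⁻¹} ∪
  {r | ∃ i j : Fin (n - 1), (i : ℕ) + 2 ≤ j ∧
      r = FreeGroup.of i * FreeGroup.of j * (FreeGroup.of j * FreeGroup.of i)⁻¹}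

/-- The braid group `B_n`. -/
abbrev BraidGroup (n : ℕ) : Type := PresentedGroup (braidRels n)

/-- The positive braid represented by a positive braid word. -/
def ofWord {n : ℕ} (w : List (Fin (n - 1))) : BraidGroup n :=
  (w.map fun i => (PresentedGroup.of i : BraidGroup n)).prod

/-- Positive braids: the products of generators. -/
def IsPositive {n : ℕ} (β : BraidGroup n) : Prop :=
  ∃ w : List (Fin (n - 1)), ofWord w = β

/-- `β'` is obtained from `β` by deleting one generator, i.e. by removing one letter of some
positive braid word that represents `β`. -/
def DeletesTo {n : ℕ} (β β' : BraidGroup n) : Prop :=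
  ∃ (u : List (Fin (n - 1))) (i : Fin (n - 1)) (v : List (Fin (n - 1))),
    β = ofWord (u ++ i :: v) ∧ β' = ofWord (u ++ v)

/-! ### Geometric braids and their closures

A geometric braid on `n` strands moves the points `0, 1, …, n - 1` of `ℂ`. -/

/-- The transposition of the positions `i` and `i + 1`. -/
def sw {n : ℕ} (i : Fin (n - 1)) : Equiv.Perm (Fin n) :=
  Equiv.swap ⟨i, by omega⟩ ⟨i + 1, by omega⟩

/-- The generator of index `i` as a motion of points: at stage `θ ∈ [0, 1]` the points `i` and
`i + 1` have been rotated counterclockwise by the angle `π θ` about their midpoint, the other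
points rest. `halfTwist i p θ` is the place of the point that started at `p`. -/
def halfTwist {n : ℕ} (i : Fin (n - 1)) (p : Fin n) (θ : ℝ) : ℂ :=
  if (p : ℕ) = i then (i : ℂ) + 1 / 2 - 1 / 2 * Complex.exp (Real.pi * θ * Complex.I)
  else if (p : ℕ) = i + 1 then (i : ℂ) + 1 / 2 + 1 / 2 * Complex.exp (Real.pi * θ * Complex.I)
  else (p : ℂ)

/-- A smooth clock: `0` for `t ≤ 1/3`, `1` for `t ≥ 2/3`. -/
def clock (t : ℝ) : ℝ := Real.smoothTransition (3 * t - 1)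

/-- The strand that starts at position `p` in the geometric braid of a positive word, at time `t`;
the letters are executed one after the other, each during a time interval of length one.
(The summand in parentheses vanishes until the first letter has been executed.) -/
def strand {n : ℕ} : List (Fin (n - 1)) → Fin n → ℝ → ℂ
  | [], p, _ => (p : ℂ)
  | i :: w, p, t => halfTwist i p (clock t) + (strand w (sw i p) (t - 1) - ((sw i p : Fin n) : ℂ))

/-- The strand that starts at position `p` ends at position `wordPerm w p`. -/
def wordPerm {n : ℕ} : List (Fin (n - 1)) → Equiv.Perm (Fin n)
  | [] => 1
  | i :: w => wordPerm w * sw i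

/-- The strand continued periodically in time, one turn of the closed braid taking time one. -/
def closedStrand {n : ℕ} (w : List (Fin (n - 1))) (p : Fin n) (s : ℝ) : ℂ :=
  strand w ((wordPerm w ^ ⌊s⌋) p) (w.length * Int.fract s)

/-- The standard embedding of the open solid torus `S¹ × ℂ` in the 3-sphere,
`(u, z) ↦ (u, z) / √(1 + |z|²)`. -/
def torusEmb (u z : ℂ) : ℂ × ℂ := (Real.sqrt (1 + Complex.normSq z))⁻¹ • (u, z)

/-- The closed braid of a positive word, in the 3-sphere. -/
def closureCurve {n : ℕ} (w : List (Fin (n - 1))) (p : Fin n) (s : ℝ) : ℂ × ℂ :=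
  torusEmb (Complex.exp (2 * Real.pi * s * Complex.I)) (closedStrand w p s)

theorem clock_of_le {t : ℝ} (h : t ≤ 1 / 3) : clock t = 0 :=
  Real.smoothTransition.zero_of_nonpos (by linarith)

theorem clock_of_ge {t : ℝ} (h : 2 / 3 ≤ t) : clock t = 1 :=
  Real.smoothTransition.one_of_one_le (by linarith)

theorem halfTwist_zero {n : ℕ} (i : Fin (n - 1)) (p : Fin n) : halfTwist i p 0 = (p : ℂ) := by
  unfold halfTwist
  split_ifs with h1 h2
  · rw [h1]; simp
  · rw [h2]; push_cast; simp; ring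
  · rfl

theorem halfTwist_one {n : ℕ} (i : Fin (n - 1)) (p : Fin n) :
    halfTwist i p 1 = ((sw i p : Fin n) : ℂ) := by
  unfold halfTwist sw
  split_ifs with h1 h2
  · have : p = ⟨i, by omega⟩ := Fin.ext h1
    rw [this, Equiv.swap_apply_left]; simp; ring
  · have : p = ⟨i + 1, by omega⟩ := Fin.ext h2
    rw [this, Equiv.swap_apply_right]; simp
  · rw [Equiv.swap_apply_of_ne_of_ne]
    · exact fun h => h1 (by rw [h])
    · exact fun h => h2 (by rw [h])

theorem halfTwist_ne {n : ℕ} (i : Fin (n - 1)) {p q : Fin n} (hpq : p ≠ q) (θ : ℝ) :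
    halfTwist i p θ ≠ halfTwist i q θ := by
  have hpq' : (p : ℕ) ≠ q := fun h => hpq (Fin.ext h)
  set e : ℂ := Complex.exp (Real.pi * θ * Complex.I) with he
  have hn : ‖e‖ = 1 := by
    rw [he, ← Complex.ofReal_mul]; exact Complex.norm_exp_ofReal_mul_I _
  have he0 : e ≠ 0 := Complex.exp_ne_zero _
  -- a resting point has distance at least 3/2 from the midpoint
  have far : ∀ r : Fin n, (r : ℕ) ≠ i → (r : ℕ) ≠ i + 1 → ∀ c : ℂ, ‖c‖ = 1 / 2 →
      (i : ℂ) + 1 / 2 + c ≠ (r : ℂ) := by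
    intro r h1 h2 c hc h
    have hc' : c = (((r : ℝ) - i - 1 / 2 : ℝ) : ℂ) := by
      push_cast; linear_combination h
    rw [hc', Complex.norm_real, Real.norm_eq_abs, abs_eq (by norm_num)] at hc
    rcases hc with hc | hc
    · exact h2 (by exact_mod_cast (by linarith : (r : ℝ) = i + 1))
    · exact h1 (by exact_mod_cast (by linarith : (r : ℝ) = i))
  have n1 : ‖(1 / 2 * e : ℂ)‖ = 1 / 2 := by rw [norm_mul, hn]; norm_num
  have n2 : ‖(-(1 / 2 * e) : ℂ)‖ = 1 / 2 := by rw [norm_neg, n1]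
  unfold halfTwist
  simp only [← he]
  split_ifs with h1 h2 h3 h4 h5 h6 h7
  · omega
  · intro h; exact he0 (by linear_combination -h)
  · rw [sub_eq_add_neg]; exact far q h2 h3 _ n2
  · intro h; exact he0 (by linear_combination h)
  · omega
  · exact far q h5 h6 _ n1
  · rw [sub_eq_add_neg]; exact (far p h1 h4 _ n2).symm
  · exact (far p h1 h4 _ n1).symm
  · exact fun h => hpq' (by exact_mod_cast h)

theorem strand_of_le {n : ℕ} (w : List (Fin (n - 1))) (p : Fin n) {t : ℝ} (h : t ≤ 1 / 3) :
    strand w p t = (p : ℂ) := by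
  induction w generalizing p t with
  | nil => rfl
  | cons i w ih => rw [strand, clock_of_le h, halfTwist_zero, ih _ (by linarith)]; ring

theorem strand_of_ge {n : ℕ} (w : List (Fin (n - 1))) (p : Fin n) {t : ℝ}
    (h : w.length - 1 / 3 ≤ t) : strand w p t = ((wordPerm w p : Fin n) : ℂ) := by
  induction w generalizing p t with
  | nil => rfl
  | cons i w ih =>
    have hl : ((i :: w).length : ℝ) = w.length + 1 := by simp
    rw [hl] at h
    have h0 : (0 : ℝ) ≤ w.length := Nat.cast_nonneg _
    rw [strand, clock_of_ge (by linarith), halfTwist_one, ih _ (by linarith)]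
    simp [wordPerm]

theorem strand_ne {n : ℕ} (w : List (Fin (n - 1))) {p q : Fin n} (hpq : p ≠ q) (t : ℝ) :
    strand w p t ≠ strand w q t := by
  induction w generalizing p q t with
  | nil => exact fun h => hpq (Fin.ext (by exact_mod_cast (show ((p : ℕ) : ℂ) = (q : ℕ) from h)))
  | cons i w ih =>
    rw [strand, strand]
    rcases le_total t 1 with h | h
    · rw [strand_of_le _ _ (by linarith), strand_of_le _ _ (by linarith)]
      simpa using halfTwist_ne i hpq (clock t)
    · rw [clock_of_ge (by linarith), halfTwist_one, halfTwist_one]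
      simpa using ih (fun h => hpq ((sw i).injective h)) (t - 1)

theorem contDiff_strand {n : ℕ} (w : List (Fin (n - 1))) (p : Fin n) :
    ContDiff ℝ ∞ (strand w p) := by
  have hclock : ContDiff ℝ ∞ (fun t : ℝ => ((clock t : ℝ) : ℂ)) :=
    Complex.ofRealCLM.contDiff.comp (Real.smoothTransition.contDiff.comp (by fun_prop))
  induction w generalizing p with
  | nil => exact contDiff_const
  | cons i w ih =>
    have h1 : ContDiff ℝ ∞ (fun t => halfTwist i p (clock t)) := by
      unfold halfTwist
      split_ifs <;> fun_prop
    have h2 : ContDiff ℝ ∞ (fun t : ℝ => strand w (sw i p) (t - 1)) :=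
      (ih (sw i p)).comp (by fun_prop)
    exact h1.add (h2.sub contDiff_const)

theorem closedStrand_add_int {n : ℕ} (w : List (Fin (n - 1))) (p : Fin n) (s : ℝ) (k : ℤ) :
    closedStrand w p (s + k) = closedStrand w ((wordPerm w ^ k) p) s := by
  unfold closedStrand
  rw [Int.floor_add_intCast, Int.fract_add_intCast, zpow_add, Equiv.Perm.mul_apply]

theorem closedStrand_ne {n : ℕ} (w : List (Fin (n - 1))) {p q : Fin n} (hpq : p ≠ q) (s : ℝ) :
    closedStrand w p s ≠ closedStrand w q s :=
  strand_ne w (fun h => hpq ((wordPerm w ^ ⌊s⌋).injective h)) _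

theorem contDiff_closedStrand {n : ℕ} (w : List (Fin (n - 1))) (p : Fin n) :
    ContDiff ℝ ∞ (closedStrand w p) := by
  -- first on the interval (-ε, 1), then everywhere by periodicity
  have key : ∀ (q : Fin n) (s : ℝ), 0 ≤ s → s < 1 → ContDiffAt ℝ ∞ (closedStrand w q) s := by
    intro q s h0 h1
    have hl : (0 : ℝ) ≤ w.length := Nat.cast_nonneg _
    have hev : closedStrand w q =ᶠ[nhds s] fun x => strand w q (w.length * x) := by
      have hε : (0 : ℝ) < 1 / (3 * (w.length + 1)) := by positivity
      have hεl : w.length * (1 / (3 * ((w.length : ℝ) + 1))) ≤ 1 / 3 := by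
        rw [mul_one_div, div_le_div_iff₀ (by positivity) (by norm_num)]; linarith
      have hε1 : 1 / (3 * ((w.length : ℝ) + 1)) ≤ 1 := by
        rw [div_le_one (by positivity)]; linarith
      filter_upwards [Ioo_mem_nhds (show -(1 / (3 * ((w.length : ℝ) + 1))) < s by linarith) h1]
        with x hx
      rcases le_or_gt 0 x with hx0 | hx0
      · have hf : ⌊x⌋ = 0 := by
          rw [Int.floor_eq_iff]; constructor <;> push_cast <;> linarith [hx.2]
        simp [closedStrand, Int.fract, hf]
      · have hf : ⌊x⌋ = -1 := by
          rw [Int.floor_eq_iff]; constructor <;> push_cast <;> linarith [hx.1]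
        have hx2 : w.length * (-x) ≤ 1 / 3 :=
          (mul_le_mul_of_nonneg_left (by linarith [hx.1]) hl).trans hεl
        have hx3 : w.length * x ≤ 0 := mul_nonpos_of_nonneg_of_nonpos hl hx0.le
        rw [strand_of_le _ _ (by linarith), closedStrand, strand_of_ge]
        · simp [hf]
        · rw [Int.fract, hf]; push_cast; nlinarith
    exact (((contDiff_strand w q).comp (by fun_prop :
      ContDiff ℝ ∞ (fun x : ℝ => w.length * x))).contDiffAt).congr_of_eventuallyEq hev
  rw [contDiff_iff_contDiffAt]
  intro s
  have hfun : closedStrand w p =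
      fun x => closedStrand w ((wordPerm w ^ ⌊s⌋) p) (x - ⌊s⌋) := by
    funext x
    rw [← closedStrand_add_int, sub_add_cancel]
  rw [hfun]
  exact ContDiffAt.comp (f := fun x : ℝ => x - ⌊s⌋) s
    (key _ _ (Int.fract_nonneg s) (Int.fract_lt_one s)) (contDiffAt_id.sub contDiffAt_const)

theorem isEmbedded_closureCurve {n : ℕ} (w : List (Fin (n - 1))) :
    IsEmbedded (wordPerm w) (closureCurve w) := by
  have hpos : ∀ z : ℂ, 0 < 1 + Complex.normSq z := fun z => by
    linarith [Complex.normSq_nonneg z]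
  have hr : ∀ z : ℂ, 0 < (Real.sqrt (1 + Complex.normSq z))⁻¹ := fun z =>
    inv_pos.2 (Real.sqrt_pos.2 (hpos z))
  have hun : ∀ s : ℝ, ‖Complex.exp (2 * Real.pi * s * Complex.I)‖ = 1 := fun s => by
    have := Complex.norm_exp_ofReal_mul_I (2 * Real.pi * s)
    push_cast at this; exact this
  have hrs : ∀ i, ContDiff ℝ ∞
      (fun s => (Real.sqrt (1 + Complex.normSq (closedStrand w i s)))⁻¹) := by
    intro i
    have hz := contDiff_closedStrand w i
    have h1 : ContDiff ℝ ∞ (fun s => 1 + Complex.normSq (closedStrand w i s)) := by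
      simp only [Complex.normSq_eq_norm_sq]
      exact contDiff_const.add (hz.norm_sq ℝ)
    exact (h1.sqrt (fun s => (hpos _).ne')).inv (fun s => (Real.sqrt_pos.2 (hpos _)).ne')
  have hexp : ContDiff ℝ ∞ (fun s : ℝ => Complex.exp (2 * Real.pi * s * Complex.I)) :=
    ((contDiff_const.mul Complex.ofRealCLM.contDiff).mul contDiff_const).cexp
  have hsm : ∀ i, ContDiff ℝ ∞ (closureCurve w i) := fun i =>
    (hrs i).smul (hexp.prodMk (contDiff_closedStrand w i))
  refine ⟨hsm, ?_, ?_, ?_⟩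
  · intro i t
    have h2 := hun t
    simp only [closureCurve, torusEmb, Prod.smul_fst, Prod.smul_snd, Complex.real_smul,
      Complex.normSq_mul, Complex.normSq_ofReal]
    rw [Complex.normSq_eq_norm_sq (Complex.exp _), h2, ← mul_add, one_pow, ← mul_inv,
      Real.mul_self_sqrt (hpos _).le, inv_mul_cancel₀ (hpos _).ne']
  · intro i t h
    -- the first coordinate is a positive function times the exponential
    obtain ⟨r', hr'⟩ : ∃ r', HasDerivAt
        (fun s => (Real.sqrt (1 + Complex.normSq (closedStrand w i s)))⁻¹) r' t :=
      ⟨_, ((hrs i).differentiable (by simp) t).hasDerivAt⟩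
    have he : HasDerivAt (fun s : ℝ => Complex.exp (2 * Real.pi * s * Complex.I))
        (Complex.exp (2 * Real.pi * t * Complex.I) * (2 * Real.pi * 1 * Complex.I)) t :=
      (((Complex.ofRealCLM.hasDerivAt (x := t)).const_mul _).mul_const _).cexp
    have h1 := hr'.smul he
    have h2 : HasDerivAt (fun s => (closureCurve w i s).1) (0 : ℂ) t := by
      have := ((hsm i).differentiable (by simp) t).hasDerivAt
      rw [h] at this
      exact (ContinuousLinearMap.fst ℝ ℂ ℂ).hasFDerivAt.comp_hasDerivAt t this
    have h3 := h2.unique h1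
    have hE := Complex.exp_ne_zero (2 * Real.pi * t * Complex.I)
    simp only [Complex.real_smul] at h3
    set r := (Real.sqrt (1 + Complex.normSq (closedStrand w i t)))⁻¹ with hrdef
    have h4 : (r : ℂ) * (2 * Real.pi * Complex.I) + r' = 0 := by
      have : Complex.exp (2 * Real.pi * t * Complex.I) *
          ((r : ℂ) * (2 * Real.pi * Complex.I) + r') = 0 := by linear_combination -h3
      exact (mul_eq_zero.1 this).resolve_left hE
    have h5 := congrArg Complex.im h4
    have h6 : r * (2 * Real.pi) = 0 := by simpa using h5
    have h7 : 0 < r * (2 * Real.pi) := mul_pos (hr _) Real.two_pi_pos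
    exact h7.ne' h6
  · intro i j s t
    constructor
    · intro h
      have ha := congrArg Prod.fst h
      have hb := congrArg Prod.snd h
      simp only [closureCurve, torusEmb, Prod.smul_fst, Prod.smul_snd, Complex.real_smul] at ha hb
      have hn := congrArg norm ha
      rw [norm_mul, norm_mul, hun, hun, mul_one, mul_one, Complex.norm_real, Complex.norm_real,
        Real.norm_of_nonneg (hr _).le, Real.norm_of_nonneg (hr _).le] at hn
      rw [hn] at ha hb
      have h0 := Complex.ofReal_ne_zero.2 (hr (closedStrand w j t)).ne'
      have ha' := mul_left_cancel₀ h0 ha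
      have hb' := mul_left_cancel₀ h0 hb
      obtain ⟨k, hk⟩ := Complex.exp_eq_exp_iff_exists_int.1 ha'
      have hst : s = t + k := by
        have h2 : (2 * Real.pi * Complex.I : ℂ) ≠ 0 := Complex.two_pi_I_ne_zero
        have : (2 * Real.pi * Complex.I : ℂ) * s = (2 * Real.pi * Complex.I) * (t + k) := by
          linear_combination hk
        exact_mod_cast mul_left_cancel₀ h2 this
      refine ⟨k, hst, ?_⟩
      rw [hst, closedStrand_add_int] at hb'
      by_contra hne
      exact closedStrand_ne w hne t hb'
    · rintro ⟨k, rfl, rfl⟩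
      have : Complex.exp (2 * Real.pi * ((t + k : ℝ) : ℂ) * Complex.I) =
          Complex.exp (2 * Real.pi * t * Complex.I) :=
        Complex.exp_eq_exp_iff_exists_int.2 ⟨k, by push_cast; ring⟩
      simp only [closureCurve, closedStrand_add_int, this]

/-- The closure of a positive braid word, as an oriented link in the 3-sphere. -/
def closure {n : ℕ} (w : List (Fin (n - 1))) : OrientedLink :=
  ⟨n, wordPerm w, closureCurve w, isEmbedded_closureCurve w⟩

/-- The link `L` is the closure of the positive braid `β` (up to isotopy; the choice of the
positive word for `β` is immaterial). -/
def IsClosure {n : ℕ} (β : BraidGroup n) (L : OrientedLink) : Prop :=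
  ∃ w : List (Fin (n - 1)), ofWord w = β ∧ Isotopic (closure w) L

/-- The positive braid word `(a_1 a_2 ⋯ a_{p-1})^q` on `p` strands. -/
def torusWord (p q : ℕ) : List (Fin (p - 1)) :=
  (List.replicate q (List.finRange (p - 1))).flatten

/-- The positive torus link `T_{p,q}`, for positive `p` and `q`. -/
def torusLink (p q : ℕ) : OrientedLink := closure (torusWord p q)

/-- `K` is subword-adjacent to `T`: for some `n`, the links `K` and `T` are the closures of
positive `n`-braids `β₁` and `β₂` such that `β₁` can be obtained from `β₂` by successively deleting
generators. -/
def SubwordAdjacent (K T : OrientedLink) : Prop :=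
  ∃ n : ℕ, 0 < n ∧ ∃ β₁ β₂ : BraidGroup n, IsPositive β₁ ∧ IsPositive β₂ ∧
    IsClosure β₁ K ∧ IsClosure β₂ T ∧ Relation.ReflTransGen DeletesTo β₂ β₁

end BraidLink

end

noncomputable section

namespace BraidLink

/-! The combinatorial core takes place in `B_4`. Put X = a₁a₃a₂. A cyclic shift shows that X^m
closes to T_{4,m}, and X² is the half twist Δ, which exchanges a₁ and a₃ under conjugation. Deleting
a single letter turns ΔX into a₁⁴a₃²a₂a₁ (`reduces_halfTwist_mul`). Outer letters pass through Δ, so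
this deletion can be iterated: X^(2t+1) reduces to a₁^(i+1) a₃^(j+1) a₂ a₁^t with i + j = 4t
(`exists_reduces_odd`), one deletion for every further Δ. Deleting the remaining a₂ and keeping one
last Δ gives Δ a₁^p a₃^q with p + q = 5t + 2, from X^(2t+3); for X^(2t+4) the additional X
contributes two more outer letters.

Since Δ = a₂a₁a₃a₂·a₃a₁, the result is a₂a₁a₃a₂ a₁^(p+1) a₃^(q+1). The word a₂a₁a₃a₂ carries a₁ to
a₃, so all outer letters can be gathered as powers of a₁, and two destabilizations yield T_{2,p+q+4}
(`isotopic_torusLink_two`). For m ≥ 3, p + q + 4 is the integer part of (5m-3)/2; smaller n are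
reached by deleting surplus outer letters.

Links here are actual smooth curves in the 3-sphere, so the moves on closures need geometric proofs:
cyclic rotation (`isotopic_closure_rotate`), far commutation and the braid relation
(`isotopic_closure_comm`, `isotopic_closure_braid`), and destabilization
(`isotopic_closure_destab`). All are carried out with curves in ℂ² ∖ {0} up to positive scaling,
where homotopies can be straight lines. The two braid relations are one statement: two words in
which each pair of strands crosses at most once, with equal length and permutation, are isotopic,
because the strands can be pushed to distinct heights. For destabilization, the additional turn of
the closed braid is put on a loop apart from the other strands and pulled across the braid axis. -/

/-! ### Curves in `ℂ² ∖ {0}` up to positive scaling -/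

/-- Radial projection of `ℂ² ∖ {0}` to the 3-sphere. -/
def normalize (v : ℂ × ℂ) : ℂ × ℂ :=
  (Real.sqrt (Complex.normSq v.1 + Complex.normSq v.2))⁻¹ • v

theorem normSq_add_pos {v : ℂ × ℂ} (hv : v ≠ 0) :
    0 < Complex.normSq v.1 + Complex.normSq v.2 := by
  rcases eq_or_ne v.1 0 with h | h
  · have h2 : v.2 ≠ 0 := fun h2 => hv (Prod.ext h h2)
    have := Complex.normSq_pos.2 h2
    have := Complex.normSq_nonneg v.1
    linarith
  · have := Complex.normSq_pos.2 h
    have := Complex.normSq_nonneg v.2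
    linarith

theorem scale_pos {v : ℂ × ℂ} (hv : v ≠ 0) :
    0 < (Real.sqrt (Complex.normSq v.1 + Complex.normSq v.2))⁻¹ :=
  inv_pos.2 (Real.sqrt_pos.2 (normSq_add_pos hv))

theorem contDiff_scale {E : Type*} [NormedAddCommGroup E] [NormedSpace ℝ E] {f : E → ℂ × ℂ}
    (hf : ContDiff ℝ ∞ f) (h0 : ∀ x, f x ≠ 0) :
    ContDiff ℝ ∞ fun x => (Real.sqrt (Complex.normSq (f x).1 + Complex.normSq (f x).2))⁻¹ := by
  have h1 : ContDiff ℝ ∞ fun x => Complex.normSq (f x).1 + Complex.normSq (f x).2 := by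
    simp only [Complex.normSq_eq_norm_sq]
    exact (hf.fst.norm_sq ℝ).add (hf.snd.norm_sq ℝ)
  exact (h1.sqrt fun x => (normSq_add_pos (h0 x)).ne').inv
    fun x => (Real.sqrt_pos.2 (normSq_add_pos (h0 x))).ne'

theorem contDiff_normalize {E : Type*} [NormedAddCommGroup E] [NormedSpace ℝ E] {f : E → ℂ × ℂ}
    (hf : ContDiff ℝ ∞ f) (h0 : ∀ x, f x ≠ 0) : ContDiff ℝ ∞ fun x => normalize (f x) :=
  (contDiff_scale hf h0).smul hf

/-- Curves in `ℂ² ∖ {0}` whose radial projection to the 3-sphere is an embedded link. -/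
structure IsConeEmbedded {n : ℕ} (π : Equiv.Perm (Fin n)) (V : Fin n → ℝ → ℂ × ℂ) : Prop where
  smooth : ∀ i, ContDiff ℝ ∞ (V i)
  ne_zero : ∀ i t, V i t ≠ 0
  transverse : ∀ i t (c : ℝ), deriv (V i) t ≠ c • V i t
  periodic : ∀ i t, V i (t + 1) = V (π i) t
  inj : ∀ i j s t (c : ℝ), 0 < c → V i s = c • V j t → ∃ k : ℤ, s = t + k ∧ (π ^ k) i = j

theorem add_int_of_add_one {n : ℕ} {E : Type*} {π : Equiv.Perm (Fin n)} {f : Fin n → ℝ → E}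
    (h : ∀ i t, f i (t + 1) = f (π i) t) (i : Fin n) (t : ℝ) (k : ℤ) :
    f i (t + k) = f ((π ^ k) i) t := by
  induction k using Int.induction_on generalizing i t with
  | zero => simp
  | succ m ih =>
    have : t + ((m + 1 : ℤ) : ℝ) = (t + (m : ℤ)) + 1 := by push_cast; ring
    rw [this, h, ih, zpow_add_one, Equiv.Perm.mul_apply]
  | pred m ih =>
    have h1 : f (π.symm i) (t + ((-m - 1 : ℤ) : ℝ) + 1) = f i (t + ((-m - 1 : ℤ) : ℝ)) := by
      rw [h, Equiv.apply_symm_apply]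
    have : t + ((-m - 1 : ℤ) : ℝ) + 1 = t + ((-m : ℤ) : ℝ) := by push_cast; ring
    rw [← h1, this, ih, zpow_sub_one, Equiv.Perm.mul_apply]
    rfl

/-- The derivative of r·V is r'V + rV', so it can vanish only if V' is a real multiple of V. Two
projections agree only if the vectors are positive multiples of each other. -/
theorem IsConeEmbedded.isEmbedded {n : ℕ} {π : Equiv.Perm (Fin n)} {V : Fin n → ℝ → ℂ × ℂ}
    (hV : IsConeEmbedded π V) : IsEmbedded π fun i t => normalize (V i t) := by
  refine ⟨fun i => contDiff_normalize (hV.smooth i) (hV.ne_zero i), ?_, ?_, ?_⟩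
  · intro i t
    have h := normSq_add_pos (hV.ne_zero i t)
    simp only [normalize, Prod.smul_fst, Prod.smul_snd, Complex.real_smul, Complex.normSq_mul,
      Complex.normSq_ofReal]
    rw [← mul_add, ← mul_inv, Real.mul_self_sqrt h.le, inv_mul_cancel₀ h.ne']
  · intro i t h
    have hr : DifferentiableAt ℝ (fun t => (Real.sqrt (Complex.normSq (V i t).1 +
        Complex.normSq (V i t).2))⁻¹) t :=
      (contDiff_scale (hV.smooth i) (hV.ne_zero i)).differentiable (by simp) t
    have hv : DifferentiableAt ℝ (V i) t := (hV.smooth i).differentiable (by simp) t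
    have h1 := (hr.hasDerivAt.smul hv.hasDerivAt).deriv
    have h2 : deriv (fun t => normalize (V i t)) t = 0 := h
    have h3 := h1.symm.trans h2
    set r := (Real.sqrt (Complex.normSq (V i t).1 + Complex.normSq (V i t).2))⁻¹ with hrdef
    have hr0 : r ≠ 0 := (scale_pos (hV.ne_zero i t)).ne'
    set d := deriv (fun t => (Real.sqrt (Complex.normSq (V i t).1 +
        Complex.normSq (V i t).2))⁻¹) t
    apply hV.transverse i t (r⁻¹ * -d)
    rw [mul_smul, eq_inv_smul_iff₀ hr0, neg_smul]
    exact eq_neg_of_add_eq_zero_left h3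
  · intro i j s t
    constructor
    · intro h
      have hi := scale_pos (hV.ne_zero i s)
      have hj := scale_pos (hV.ne_zero j t)
      simp only [normalize] at h
      refine hV.inj i j s t _ (mul_pos (inv_pos.2 hi) hj) ?_
      rw [mul_smul, ← h, inv_smul_smul₀ hi.ne']
    · rintro ⟨k, rfl, rfl⟩
      simp only [add_int_of_add_one hV.periodic]

/-- The link that is the radial projection of curves in `ℂ² ∖ {0}`. -/
def coneLink {n : ℕ} {π : Equiv.Perm (Fin n)} {V : Fin n → ℝ → ℂ × ℂ}
    (hV : IsConeEmbedded π V) : OrientedLink :=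
  ⟨n, π, fun i t => normalize (V i t), hV.isEmbedded⟩

/-- An isotopy must be smooth for every real parameter, while V may hit the origin outside [0, 1].
Composing with `Real.smoothTransition` keeps the parameter in [0, 1] and fixes both ends. -/
theorem smoothIsotopy_of_cone {n : ℕ} {π : Equiv.Perm (Fin n)} {V : ℝ → Fin n → ℝ → ℂ × ℂ}
    (hs : ∀ i, ContDiff ℝ ∞ fun x : ℝ × ℝ => V x.1 i x.2)
    (hV : ∀ τ ∈ Set.Icc (0 : ℝ) 1, IsConeEmbedded π (V τ)) {K L : OrientedLink}
    (hK : SameOriented K.curve fun i t => normalize (V 0 i t))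
    (hL : SameOriented (fun i t => normalize (V 1 i t)) L.curve) : SmoothIsotopy K L := by
  have hmem : ∀ τ, Real.smoothTransition τ ∈ Set.Icc (0 : ℝ) 1 := fun τ =>
    ⟨Real.smoothTransition.nonneg τ, Real.smoothTransition.le_one τ⟩
  refine ⟨n, π, fun τ i t => normalize (V (Real.smoothTransition τ) i t), ?_, ?_, ?_, ?_⟩
  · intro i
    refine contDiff_normalize
      (f := fun x : ℝ × ℝ => V (Real.smoothTransition x.1) i x.2) ?_
      fun x => (hV _ (hmem x.1)).ne_zero i x.2
    exact (hs i).comp ((Real.smoothTransition.contDiff.comp contDiff_fst).prodMk contDiff_snd)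
  · exact fun τ _ => (hV _ (hmem τ)).isEmbedded
  · simpa using hK
  · simpa using hL

/-! ### Reparametrization -/

theorem IsEmbedded.add_int {n : ℕ} {π : Equiv.Perm (Fin n)} {γ : Fin n → ℝ → ℂ × ℂ}
    (h : IsEmbedded π γ) (i : Fin n) (t : ℝ) (k : ℤ) : γ i (t + k) = γ ((π ^ k) i) t :=
  (h.eq_iff _ _ _ _).2 ⟨k, rfl, rfl⟩

theorem IsEmbedded.deriv_add_int {n : ℕ} {π : Equiv.Perm (Fin n)} {γ : Fin n → ℝ → ℂ × ℂ}
    (h : IsEmbedded π γ) (i : Fin n) (t : ℝ) (k : ℤ) :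
    deriv (γ i) (t + k) = deriv (γ ((π ^ k) i)) t := by
  rw [← deriv_comp_add_const]
  congr 1
  funext x
  exact h.add_int i x k

/-- Two parametrizations of the same oriented link: it suffices to compare them over one period. -/
theorem sameOriented_of_reparam {n n' : ℕ} {π : Equiv.Perm (Fin n)} {π' : Equiv.Perm (Fin n')}
    {γ : Fin n → ℝ → ℂ × ℂ} {γ' : Fin n' → ℝ → ℂ × ℂ} (hγ : IsEmbedded π γ)
    (hγ' : IsEmbedded π' γ') (e : Fin n → Fin n') (h : Fin n → ℝ → ℝ)
    (hd : ∀ q, ∀ s ∈ Set.Ico (0 : ℝ) 1, ∃ d, 0 < d ∧ HasDerivAt (h q) d s)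
    (heq : ∀ q, ∀ s ∈ Set.Ico (0 : ℝ) 1, γ q s = γ' (e q) (h q s))
    (hsurj : ∀ p, ∀ t ∈ Set.Ico (0 : ℝ) 1, ∃ q s, γ' p t = γ q s) :
    SameOriented γ γ' ∧ SameOriented γ' γ := by
  have hfr : ∀ s : ℝ, Int.fract s ∈ Set.Ico (0 : ℝ) 1 := fun s =>
    ⟨Int.fract_nonneg s, Int.fract_lt_one s⟩
  have himg : (⋃ i, Set.range (γ i)) = (⋃ i, Set.range (γ' i)) := by
    apply Set.Subset.antisymm
    · apply Set.iUnion_subset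
      rintro i _ ⟨s, rfl⟩
      rw [← Int.fract_add_floor s, hγ.add_int, heq _ _ (hfr s)]
      exact Set.mem_iUnion.2 ⟨_, Set.mem_range_self _⟩
    · apply Set.iUnion_subset
      rintro i _ ⟨s, rfl⟩
      rw [← Int.fract_add_floor s, hγ'.add_int]
      obtain ⟨q, t, hq⟩ := hsurj ((π' ^ ⌊s⌋) i) _ (hfr s)
      rw [hq]
      exact Set.mem_iUnion.2 ⟨_, Set.mem_range_self _⟩
  have hder : ∀ i j s t, γ i s = γ' j t →
      ∃ c : ℝ, 0 < c ∧ deriv (γ i) s = c • deriv (γ' j) t := by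
    intro i j s t hst
    set q := (π ^ ⌊s⌋) i with hq
    set x := Int.fract s with hx
    have h1 : γ i s = γ q x := by rw [hq, ← hγ.add_int, hx, Int.fract_add_floor]
    have h2 : deriv (γ i) s = deriv (γ q) x := by
      rw [hq, ← hγ.deriv_add_int, hx, Int.fract_add_floor]
    have hxm : x ∈ Set.Ico (0 : ℝ) 1 := hfr s
    obtain ⟨k, hk, hk'⟩ := (hγ'.eq_iff (e q) j (h q x) t).1 (by rw [← heq q x hxm, ← h1, hst])
    obtain ⟨d, hd0, hdd⟩ := hd q x hxm
    refine ⟨d, hd0, ?_⟩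
    have h3 : HasDerivAt (γ' (e q)) (deriv (γ' j) t) (h q x) := by
      rw [← hk', ← hγ'.deriv_add_int, ← hk]
      exact ((hγ'.smooth (e q)).differentiable (by simp) _).hasDerivAt
    -- Only derivatives from the right are compared: `heq` is known on [0, 1) and gives nothing to
    -- the left of 0.
    have h4 := (h3.scomp x hdd).hasDerivWithinAt (s := Set.Ici x)
    have h5 : HasDerivWithinAt (γ q) (deriv (γ q) x) (Set.Ici x) x :=
      (((hγ.smooth q).differentiable (by simp) x).hasDerivAt).hasDerivWithinAt
    have h6 : HasDerivWithinAt (γ q) (d • deriv (γ' j) t) (Set.Ici x) x := by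
      refine h4.congr_of_eventuallyEq ?_ (heq q x hxm)
      have : Set.Ico x 1 ∈ nhdsWithin x (Set.Ici x) := Ico_mem_nhdsGE hxm.2
      filter_upwards [this] with y hy
      exact heq q y ⟨hxm.1.trans hy.1, hy.2⟩
    rw [h2]
    exact (uniqueDiffWithinAt_Ici x).eq_deriv _ h5 h6
  refine ⟨⟨himg, ?_⟩, ⟨himg.symm, ?_⟩⟩
  · intro i j s t hst
    obtain ⟨c, hc, h1⟩ := hder i j s t hst
    exact ⟨c⁻¹, inv_pos.2 hc, by rw [h1, inv_smul_smul₀ hc.ne']⟩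
  · intro i j s t hst
    exact hder j i t s hst.symm

theorem IsEmbedded.sameOriented_refl {n : ℕ} {π : Equiv.Perm (Fin n)} {γ : Fin n → ℝ → ℂ × ℂ}
    (h : IsEmbedded π γ) : SameOriented γ γ :=
  (sameOriented_of_reparam h h id (fun _ => id) (fun _ s _ => ⟨1, one_pos, hasDerivAt_id s⟩)
    (fun _ _ _ => rfl) (fun p t _ => ⟨p, t, rfl⟩)).1

/-! ### Periodic continuation -/

/-- The periodic continuation of curves defined near `[0, 1]`. -/
def periodize {E : Type*} {n : ℕ} (π : Equiv.Perm (Fin n)) (f : Fin n → ℝ → E) (p : Fin n)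
    (s : ℝ) : E :=
  f ((π ^ ⌊s⌋) p) (Int.fract s)

theorem periodize_add_one {E : Type*} {n : ℕ} (π : Equiv.Perm (Fin n)) (f : Fin n → ℝ → E)
    (p : Fin n) (s : ℝ) : periodize π f p (s + 1) = periodize π f (π p) s := by
  unfold periodize
  rw [Int.floor_add_one, Int.fract_add_one, zpow_add_one, Equiv.Perm.mul_apply]

theorem periodize_of_mem {E : Type*} {n : ℕ} (π : Equiv.Perm (Fin n)) (f : Fin n → ℝ → E)
    (p : Fin n) {s : ℝ} (hs : s ∈ Set.Ico (0 : ℝ) 1) : periodize π f p s = f p s := by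
  unfold periodize
  rw [Int.floor_eq_zero_iff.2 hs, Int.fract_eq_self.2 hs]
  simp

/-- By `hper` consecutive branches agree on an interval before each integer, so near every point the
continuation is a single translated branch. -/
theorem contDiff_periodize₂ {E : Type*} [NormedAddCommGroup E] [NormedSpace ℝ E] {n : ℕ}
    {π : Equiv.Perm (Fin n)} {f : ℝ → Fin n → ℝ → E} {ε : ℝ} (hε : 0 < ε)
    (hf : ∀ p, ContDiff ℝ ∞ fun x : ℝ × ℝ => f x.1 p x.2)
    (hper : ∀ τ p s, -ε < s → s < 0 → f τ p (s + 1) = f τ (π p) s) (p : Fin n) :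
    ContDiff ℝ ∞ fun x : ℝ × ℝ => periodize π (f x.1) p x.2 := by
  rw [contDiff_iff_contDiffAt]
  rintro ⟨τ, s⟩
  set k := ⌊s⌋ with hk
  have hk1 : (k : ℝ) ≤ s := Int.floor_le s
  have hk2 : s < k + 1 := Int.lt_floor_add_one s
  have key : ∀ σ x : ℝ, k - min ε 1 < x → x < k + 1 →
      periodize π (f σ) p x = f σ ((π ^ k) p) (x - k) := by
    intro σ x h1 h2
    rcases le_or_gt (k : ℝ) x with hx | hx
    · have hf : ⌊x⌋ = k := Int.floor_eq_iff.2 ⟨hx, h2⟩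
      simp [periodize, Int.fract, hf]
    · have hf : ⌊x⌋ = k - 1 := by
        rw [Int.floor_eq_iff]
        push_cast
        constructor <;> linarith [min_le_right ε 1]
      have h3 := hper σ ((π ^ (k - 1)) p) (x - k) (by linarith [min_le_left ε 1]) (by linarith)
      simp only [periodize, Int.fract, hf]
      rw [show x - ((k - 1 : ℤ) : ℝ) = x - k + 1 by push_cast; ring, h3, ← Equiv.Perm.mul_apply,
        ← zpow_one_add, add_sub_cancel]
  have hev : (fun x : ℝ × ℝ => periodize π (f x.1) p x.2) =ᶠ[nhds (τ, s)]
      fun x => f x.1 ((π ^ k) p) (x.2 - k) := by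
    have hmin : 0 < min ε 1 := lt_min hε one_pos
    have : Set.Ioo ((k : ℝ) - min ε 1) (k + 1) ∈ nhds s :=
      Ioo_mem_nhds (by linarith) hk2
    filter_upwards [continuous_snd.continuousAt.preimage_mem_nhds this] with x hx
    exact key x.1 x.2 hx.1 hx.2
  refine ContDiffAt.congr_of_eventuallyEq ?_ hev
  have hc : ContDiff ℝ ∞ fun x : ℝ × ℝ => (x.1, x.2 - (k : ℝ)) :=
    contDiff_fst.prodMk (contDiff_snd.sub contDiff_const)
  exact ((hf ((π ^ k) p)).comp hc).contDiffAt

theorem contDiff_periodize {E : Type*} [NormedAddCommGroup E] [NormedSpace ℝ E] {n : ℕ}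
    {π : Equiv.Perm (Fin n)} {f : Fin n → ℝ → E} {ε : ℝ} (hε : 0 < ε)
    (hf : ∀ p, ContDiff ℝ ∞ (f p))
    (hper : ∀ p s, -ε < s → s < 0 → f p (s + 1) = f (π p) s) (p : Fin n) :
    ContDiff ℝ ∞ (periodize π f p) :=
  (contDiff_periodize₂ (f := fun _ => f) hε (fun p => (hf p).comp contDiff_snd)
    (fun _ => hper) p).comp (contDiff_const (c := (0 : ℝ)) |>.prodMk contDiff_id)

/-! ### Closed braids -/

/-- A closed braid, given by the motion of its points in `ℂ`. -/
structure IsClosedBraid {n : ℕ} (π : Equiv.Perm (Fin n)) (z : Fin n → ℝ → ℂ) : Prop where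
  smooth : ∀ p, ContDiff ℝ ∞ (z p)
  periodic : ∀ p s, z p (s + 1) = z (π p) s
  ne : ∀ p q s, p ≠ q → z p s ≠ z q s

/-- The point of the unit circle at time `s`. -/
def circ (s : ℝ) : ℂ := Complex.exp (2 * Real.pi * s * Complex.I)

theorem norm_circ (s : ℝ) : ‖circ s‖ = 1 := by
  have := Complex.norm_exp_ofReal_mul_I (2 * Real.pi * s)
  push_cast at this
  exact this

theorem circ_ne_zero (s : ℝ) : circ s ≠ 0 := Complex.exp_ne_zero _

theorem circ_add (s t : ℝ) : circ (s + t) = circ s * circ t := by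
  unfold circ
  rw [← Complex.exp_add]
  congr 1
  push_cast
  ring

theorem circ_eq_iff {s t : ℝ} : circ s = circ t ↔ ∃ k : ℤ, s = t + k := by
  unfold circ
  rw [Complex.exp_eq_exp_iff_exists_int]
  have h2 : (2 * Real.pi * Complex.I : ℂ) ≠ 0 := Complex.two_pi_I_ne_zero
  constructor
  · rintro ⟨k, hk⟩
    refine ⟨k, ?_⟩
    have : (2 * Real.pi * Complex.I : ℂ) * s = (2 * Real.pi * Complex.I) * (t + k) := by
      linear_combination hk
    exact_mod_cast mul_left_cancel₀ h2 this
  · rintro ⟨k, rfl⟩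
    exact ⟨k, by push_cast; ring⟩

theorem circ_int (k : ℤ) : circ k = 1 := by
  have : circ (k : ℝ) = circ 0 := circ_eq_iff.2 ⟨k, by simp⟩
  rw [this]
  simp [circ]

theorem hasDerivAt_circ (s : ℝ) : HasDerivAt circ (circ s * (2 * Real.pi * Complex.I)) s := by
  have : HasDerivAt (fun s : ℝ => Complex.exp (2 * Real.pi * s * Complex.I))
      (Complex.exp (2 * Real.pi * s * Complex.I) * (2 * Real.pi * 1 * Complex.I)) s :=
    (((Complex.ofRealCLM.hasDerivAt (x := s)).const_mul _).mul_const _).cexp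
  simp only [mul_one] at this
  exact this

theorem contDiff_circ : ContDiff ℝ ∞ circ :=
  ((contDiff_const.mul Complex.ofRealCLM.contDiff).mul contDiff_const).cexp

/-- The closed braid as a system of curves in `ℂ² ∖ {0}`. -/
def braidCone {n : ℕ} (z : Fin n → ℝ → ℂ) (p : Fin n) (s : ℝ) : ℂ × ℂ := (circ s, z p s)

/-- A curve that moves transversely along the unit circle is nowhere radial. -/
theorem ne_smul_of_hasDerivWithinAt_circ {V : ℝ → ℂ × ℂ} {s : ℝ} (hV : DifferentiableAt ℝ V s)
    (h1 : HasDerivWithinAt (fun x => (V x).1) (circ s * (2 * Real.pi * Complex.I)) (Set.Ici s) s)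
    (h2 : (V s).1 = circ s) (c : ℝ) : deriv V s ≠ c • V s := by
  intro h
  have h3 : HasDerivWithinAt (fun x => (V x).1) (c • V s).1 (Set.Ici s) s := by
    have := hV.hasDerivAt
    rw [h] at this
    exact ((ContinuousLinearMap.fst ℝ ℂ ℂ).hasFDerivAt.comp_hasDerivAt s this).hasDerivWithinAt
  have h4 := (uniqueDiffWithinAt_Ici s).eq_deriv _ h3 h1
  rw [Prod.smul_fst, h2, Complex.real_smul, mul_comm] at h4
  -- The velocity of the circle is 2πi times its position; a radial velocity would be a real
  -- multiple.
  have h5 := congrArg Complex.im (mul_left_cancel₀ (circ_ne_zero s) h4)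
  simp at h5

theorem IsClosedBraid.isConeEmbedded {n : ℕ} {π : Equiv.Perm (Fin n)} {z : Fin n → ℝ → ℂ}
    (hz : IsClosedBraid π z) : IsConeEmbedded π (braidCone z) := by
  have hs : ∀ i, ContDiff ℝ ∞ (braidCone z i) := fun i => contDiff_circ.prodMk (hz.smooth i)
  refine ⟨hs, ?_, ?_, ?_, ?_⟩
  · exact fun i t h => circ_ne_zero t (congrArg Prod.fst h)
  · intro i t c
    exact ne_smul_of_hasDerivWithinAt_circ ((hs i).differentiable (by simp) t)
      (hasDerivAt_circ t).hasDerivWithinAt rfl c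
  · intro i t
    have : circ (t + 1) = circ t := circ_eq_iff.2 ⟨1, by simp⟩
    simp only [braidCone, this, hz.periodic]
  · intro i j s t c hc h
    have ha : circ s = c • circ t := congrArg Prod.fst h
    have hb : z i s = c • z j t := congrArg Prod.snd h
    have hc1 : c = 1 := by
      have := congrArg norm ha
      rw [norm_smul, norm_circ, norm_circ, Real.norm_of_nonneg hc.le, mul_one] at this
      exact this.symm
    rw [hc1, one_smul] at ha hb
    obtain ⟨k, rfl⟩ := circ_eq_iff.1 ha
    refine ⟨k, rfl, ?_⟩
    rw [add_int_of_add_one hz.periodic] at hb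
    by_contra hne
    exact hz.ne _ _ t hne hb

/-- The link of a closed braid. -/
def braidLink {n : ℕ} {π : Equiv.Perm (Fin n)} {z : Fin n → ℝ → ℂ} (hz : IsClosedBraid π z) :
    OrientedLink :=
  coneLink hz.isConeEmbedded

theorem smoothIsotopy_braidLink {n : ℕ} {π : Equiv.Perm (Fin n)} {H : ℝ → Fin n → ℝ → ℂ}
    (hs : ∀ p, ContDiff ℝ ∞ fun x : ℝ × ℝ => H x.1 p x.2)
    (hper : ∀ τ p s, H τ p (s + 1) = H τ (π p) s)
    (hne : ∀ τ ∈ Set.Icc (0 : ℝ) 1, ∀ p q s, p ≠ q → H τ p s ≠ H τ q s)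
    {z z' : Fin n → ℝ → ℂ} (hz : IsClosedBraid π z) (hz' : IsClosedBraid π z')
    (h0 : H 0 = z) (h1 : H 1 = z') : SmoothIsotopy (braidLink hz) (braidLink hz') := by
  have hcb : ∀ τ ∈ Set.Icc (0 : ℝ) 1, IsClosedBraid π (H τ) := fun τ hτ =>
    ⟨fun p => (hs p).comp (contDiff_const.prodMk contDiff_id), hper τ, hne τ hτ⟩
  refine smoothIsotopy_of_cone (V := fun τ => braidCone (H τ)) (π := π) ?_
    (fun τ hτ => (hcb τ hτ).isConeEmbedded) ?_ ?_
  · exact fun p => (contDiff_circ.comp contDiff_snd).prodMk (hs p)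
  · subst h0
    exact hz.isConeEmbedded.isEmbedded.sameOriented_refl
  · subst h1
    exact hz'.isConeEmbedded.isEmbedded.sameOriented_refl

/-- Two closed braids are isotopic if the straight-line homotopy has no collisions. -/
theorem smoothIsotopy_of_linear {n : ℕ} {π : Equiv.Perm (Fin n)} {z z' : Fin n → ℝ → ℂ}
    (hz : IsClosedBraid π z) (hz' : IsClosedBraid π z')
    (h : ∀ p q s, s ∈ Set.Ico (0 : ℝ) 1 → p ≠ q → ∀ τ ∈ Set.Ioo (0 : ℝ) 1,
      (1 - τ) * (z p s - z q s) + τ * (z' p s - z' q s) ≠ 0) :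
    SmoothIsotopy (braidLink hz) (braidLink hz') := by
  refine smoothIsotopy_braidLink (H := fun τ p s => (1 - τ : ℝ) * z p s + (τ : ℝ) * z' p s)
    ?_ ?_ ?_ hz hz' ?_ ?_
  · intro p
    have h1 : ContDiff ℝ ∞ fun x : ℝ × ℝ => z p x.2 := (hz.smooth p).comp contDiff_snd
    have h2 : ContDiff ℝ ∞ fun x : ℝ × ℝ => z' p x.2 := (hz'.smooth p).comp contDiff_snd
    have h3 : ContDiff ℝ ∞ fun x : ℝ × ℝ => ((x.1 : ℝ) : ℂ) :=
      Complex.ofRealCLM.contDiff.comp contDiff_fst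
    have h4 : ContDiff ℝ ∞ fun x : ℝ × ℝ => ((1 - x.1 : ℝ) : ℂ) :=
      Complex.ofRealCLM.contDiff.comp (contDiff_const.sub contDiff_fst)
    exact (h4.mul h1).add (h3.mul h2)
  · intro τ p s
    simp only [hz.periodic, hz'.periodic]
  · intro τ hτ p q s hpq heq
    have hp : ∀ i, z i s = z ((π ^ ⌊s⌋) i) (Int.fract s) := fun i => by
      rw [← add_int_of_add_one hz.periodic, Int.fract_add_floor]
    have hp' : ∀ i, z' i s = z' ((π ^ ⌊s⌋) i) (Int.fract s) := fun i => by
      rw [← add_int_of_add_one hz'.periodic, Int.fract_add_floor]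
    rcases hτ.1.eq_or_lt with h0 | h0
    · subst h0
      exact hz.ne p q s hpq (by simpa using heq)
    rcases hτ.2.eq_or_lt with h1 | h1
    · subst h1
      exact hz'.ne p q s hpq (by simpa using heq)
    refine h _ _ (Int.fract s) ⟨Int.fract_nonneg s, Int.fract_lt_one s⟩
      (fun hh => hpq ((π ^ ⌊s⌋).injective hh)) τ ⟨h0, h1⟩ ?_
    rw [← hp p, ← hp q, ← hp' p, ← hp' q]
    push_cast at heq
    linear_combination heq
  · funext p s
    simp
  · funext p s
    simp

theorem isClosedBraid_closedStrand {n : ℕ} (w : List (Fin (n - 1))) :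
    IsClosedBraid (wordPerm w) (closedStrand w) :=
  ⟨contDiff_closedStrand w, fun p s => by simpa using closedStrand_add_int w p s 1,
    fun _ _ s h => closedStrand_ne w h s⟩

theorem closure_eq_braidLink {n : ℕ} (w : List (Fin (n - 1))) :
    closure w = braidLink (isClosedBraid_closedStrand w) := by
  have : closureCurve w = fun i t => normalize (braidCone (closedStrand w) i t) := by
    funext i t
    have h : Complex.normSq (circ t) = 1 := by
      rw [Complex.normSq_eq_norm_sq, norm_circ, one_pow]
    simp only [closureCurve, torusEmb, normalize, braidCone, h]
    rfl
  simp only [closure, braidLink, coneLink, this]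

theorem isotopic_of_smooth {K L : OrientedLink} (h : SmoothIsotopy K L) : Isotopic K L :=
  Relation.EqvGen.rel _ _ h

theorem Isotopic.trans {K L M : OrientedLink} (h : Isotopic K L) (h' : Isotopic L M) :
    Isotopic K M := Relation.EqvGen.trans _ _ _ h h'

theorem Isotopic.symm {K L : OrientedLink} (h : Isotopic K L) : Isotopic L K :=
  Relation.EqvGen.symm _ _ h

theorem Isotopic.refl (K : OrientedLink) : Isotopic K K := Relation.EqvGen.refl _

/-! ### Rotation of braid words -/

theorem strand_append {n : ℕ} (u v : List (Fin (n - 1))) (p : Fin n) (t : ℝ) :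
    strand (u ++ v) p t =
      strand u p t + (strand v (wordPerm u p) (t - u.length) - ((wordPerm u p : Fin n) : ℂ)) := by
  induction u generalizing p t with
  | nil => simp [strand, wordPerm]
  | cons i u ih =>
    rw [List.cons_append, strand, strand, ih]
    have : t - 1 - (u.length : ℝ) = t - ((i :: u).length : ℝ) := by
      simp only [List.length_cons]
      push_cast
      ring
    rw [this]
    simp only [wordPerm, Equiv.Perm.mul_apply]
    ring

theorem wordPerm_append {n : ℕ} (u v : List (Fin (n - 1))) :
    wordPerm (u ++ v) = wordPerm v * wordPerm u := by
  induction u with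
  | nil => simp [wordPerm]
  | cons i u ih => rw [List.cons_append, wordPerm, ih, wordPerm, mul_assoc]

/-- One letter takes the time 1 / (l + 1). After this delay the reading starts with `w`; past the
end of the period the first letter comes again and plays the role of the appended one. -/
theorem closedStrand_rotate {n : ℕ} (i : Fin (n - 1)) (w : List (Fin (n - 1))) (p : Fin n) {s : ℝ}
    (hs : s ∈ Set.Ico (0 : ℝ) 1) :
    closedStrand (i :: w) p (s + 1 / (w.length + 1)) = closedStrand (w ++ [i]) (sw i p) s := by
  have hL : (0 : ℝ) < w.length + 1 := by positivity
  have hL1 : 1 / ((w.length : ℝ) + 1) ≤ 1 := by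
    rw [div_le_one hL]
    linarith [(Nat.cast_nonneg w.length : (0 : ℝ) ≤ w.length)]
  have hL0 : 0 < 1 / ((w.length : ℝ) + 1) := by positivity
  have hmul : ((w.length : ℝ) + 1) * (1 / (w.length + 1)) = 1 := mul_one_div_cancel hL.ne'
  have hc : ((i :: w).length : ℝ) = w.length + 1 := by simp
  have ha : ((w ++ [i]).length : ℝ) = w.length + 1 := by simp
  have hR : closedStrand (w ++ [i]) (sw i p) s =
      strand (w ++ [i]) (sw i p) ((w.length + 1) * s) := by
    simp only [closedStrand, Int.floor_eq_zero_iff.2 hs, Int.fract_eq_self.2 hs, ha]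
    simp
  rw [hR, strand_append]
  rcases lt_or_ge (s + 1 / ((w.length : ℝ) + 1)) 1 with h | h
  · have hs' : s + 1 / ((w.length : ℝ) + 1) ∈ Set.Ico (0 : ℝ) 1 := ⟨by linarith [hs.1], h⟩
    have ht : (w.length + 1) * s - w.length ≤ 1 / 3 := by nlinarith
    simp only [closedStrand, Int.floor_eq_zero_iff.2 hs', Int.fract_eq_self.2 hs', hc]
    rw [strand_of_le [i] _ ht, mul_add, hmul, strand, clock_of_ge (by nlinarith [hs.1]),
      halfTwist_one]
    simp
  · have hf : ⌊s + 1 / ((w.length : ℝ) + 1)⌋ = 1 := by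
      rw [Int.floor_eq_iff]
      push_cast
      exact ⟨h, by linarith [hs.2]⟩
    have ht : (w.length : ℝ) ≤ (w.length + 1) * s := by nlinarith
    have ht2 : (w.length + 1) * s < w.length + 1 := by nlinarith [hs.2]
    simp only [closedStrand, Int.fract, hf, hc, zpow_one]
    have e1 : ((w.length : ℝ) + 1) * (s + 1 / (w.length + 1) - ((1 : ℤ) : ℝ)) =
        (w.length + 1) * s - w.length := by
      push_cast
      rw [mul_sub, mul_add, hmul]
      ring
    rw [e1, strand, strand_of_le w _ (by linarith), strand_of_ge w (sw i p) (by linarith)]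
    simp [strand, wordPerm]

/-- The isotopy advances the strands in time and leaves the circle coordinate alone, which rotates
the closed braid about its axis. It ends at the other closure with the strands relabelled by `sw i`.
-/
theorem isotopic_closure_rotate_cons {n : ℕ} (i : Fin (n - 1)) (w : List (Fin (n - 1))) :
    Isotopic (closure (i :: w)) (closure (w ++ [i])) := by
  apply isotopic_of_smooth
  rw [closure_eq_braidLink, closure_eq_braidLink]
  set H : ℝ → Fin n → ℝ → ℂ := fun τ p s =>
    closedStrand (i :: w) p (s + τ * (1 / (w.length + 1))) with hH
  have hs : ∀ p, ContDiff ℝ ∞ fun x : ℝ × ℝ => H x.1 p x.2 := fun p =>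
    (contDiff_closedStrand (i :: w) p).comp
      (contDiff_snd.add (contDiff_fst.mul contDiff_const))
  have hcb : ∀ τ, IsClosedBraid (wordPerm (i :: w)) (H τ) := fun τ =>
    ⟨fun p => (hs p).comp (contDiff_const.prodMk contDiff_id), fun p s => by
      simp only [hH]
      rw [add_right_comm, (isClosedBraid_closedStrand (i :: w)).periodic],
      fun p q s h => closedStrand_ne (i :: w) h _⟩
  refine smoothIsotopy_of_cone (V := fun τ => braidCone (H τ)) (π := wordPerm (i :: w))
    (fun p => (contDiff_circ.comp contDiff_snd).prodMk (hs p))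
    (fun τ _ => (hcb τ).isConeEmbedded) ?_ ?_
  · have : H 0 = closedStrand (i :: w) := by
      funext p s
      simp [hH]
    rw [this]
    exact (isClosedBraid_closedStrand (i :: w)).isConeEmbedded.isEmbedded.sameOriented_refl
  · refine (sameOriented_of_reparam (hcb 1).isConeEmbedded.isEmbedded
      (isClosedBraid_closedStrand (w ++ [i])).isConeEmbedded.isEmbedded (sw i) (fun _ => id)
      (fun _ s _ => ⟨1, one_pos, hasDerivAt_id s⟩) ?_ ?_).1
    · intro q s hs'
      simp only [braidCone, hH, one_mul, id, closedStrand_rotate i w q hs']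
    · intro p t ht
      refine ⟨(sw i).symm p, t, ?_⟩
      simp only [braidCone, hH, one_mul, closedStrand_rotate i w _ ht, Equiv.apply_symm_apply]

theorem isotopic_closure_rotate {n : ℕ} (u v : List (Fin (n - 1))) :
    Isotopic (closure (u ++ v)) (closure (v ++ u)) := by
  induction u generalizing v with
  | nil =>
    rw [List.nil_append, List.append_nil]
    exact Isotopic.refl _
  | cons i u ih =>
    have h := ih (v ++ [i])
    rw [← List.append_assoc, List.append_assoc v, List.singleton_append] at h
    rw [List.cons_append]
    exact (isotopic_closure_rotate_cons i (u ++ v)).trans h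

/-! ### Positions of strands -/

theorem sw_val {n : ℕ} (i : Fin (n - 1)) (p : Fin n) :
    (sw i p : ℕ) = if (p : ℕ) = i then (i : ℕ) + 1 else if (p : ℕ) = i + 1 then (i : ℕ) else p := by
  unfold sw
  rw [Equiv.swap_apply_def]
  simp only [Fin.ext_iff]
  split_ifs <;> rfl

theorem halfTwist_re {n : ℕ} (i : Fin (n - 1)) (p : Fin n) (θ : ℝ) :
    (halfTwist i p θ).re = if (p : ℕ) = i then (i : ℝ) + 1 / 2 - 1 / 2 * Real.cos (Real.pi * θ)
      else if (p : ℕ) = i + 1 then (i : ℝ) + 1 / 2 + 1 / 2 * Real.cos (Real.pi * θ) else (p : ℝ) := by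
  unfold halfTwist
  have h : Complex.exp (Real.pi * θ * Complex.I) =
      Real.cos (Real.pi * θ) + Real.sin (Real.pi * θ) * Complex.I := by
    rw [← Complex.ofReal_mul, Complex.exp_mul_I, Complex.ofReal_cos, Complex.ofReal_sin]
  rw [h]
  split_ifs <;> simp [-Complex.ofReal_cos, -Complex.ofReal_sin]

theorem halfTwist_im {n : ℕ} (i : Fin (n - 1)) (p : Fin n) (θ : ℝ) :
    (halfTwist i p θ).im = if (p : ℕ) = i then - (1 / 2 * Real.sin (Real.pi * θ))
      else if (p : ℕ) = i + 1 then 1 / 2 * Real.sin (Real.pi * θ) else 0 := by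
  unfold halfTwist
  have h : Complex.exp (Real.pi * θ * Complex.I) =
      Real.cos (Real.pi * θ) + Real.sin (Real.pi * θ) * Complex.I := by
    rw [← Complex.ofReal_mul, Complex.exp_mul_I, Complex.ofReal_cos, Complex.ofReal_sin]
  rw [h]
  split_ifs <;> simp [-Complex.ofReal_cos, -Complex.ofReal_sin]

theorem halfTwist_re_lt {n : ℕ} {i : Fin (n - 1)} {p q : Fin n} (hpq : (p : ℕ) < q)
    (h : ¬ ((p : ℕ) = i ∧ (q : ℕ) = i + 1)) (θ : ℝ) :
    (halfTwist i p θ).re < (halfTwist i q θ).re := by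
  rw [halfTwist_re, halfTwist_re]
  have h1 := Real.cos_le_one (Real.pi * θ)
  have h2 := Real.neg_one_le_cos (Real.pi * θ)
  have hc : ∀ a b : ℕ, a < b → (a : ℝ) + 1 ≤ b := fun a b h => by exact_mod_cast h
  split_ifs with a b c d e f g
  · omega
  · omega
  · have := hc (i + 1) q (by omega)
    push_cast at this
    linarith
  · omega
  · omega
  · have := hc (i + 1) q (by omega)
    push_cast at this
    linarith
  · have := hc p i (by omega)
    linarith
  · have := hc p i (by omega)
    linarith
  · have := hc p q hpq
    linarith

theorem clock_mem (t : ℝ) : clock t ∈ Set.Icc (0 : ℝ) 1 :=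
  ⟨Real.smoothTransition.nonneg _, Real.smoothTransition.le_one _⟩

theorem sin_clock_nonneg (t : ℝ) : 0 ≤ Real.sin (Real.pi * clock t) := by
  apply Real.sin_nonneg_of_nonneg_of_le_pi (mul_nonneg Real.pi_pos.le (clock_mem t).1)
  nlinarith [Real.pi_pos, (clock_mem t).2]

theorem strand_cons_of_le {n : ℕ} (i : Fin (n - 1)) (w : List (Fin (n - 1))) (p : Fin n) {t : ℝ}
    (h : t ≤ 4 / 3) : strand (i :: w) p t = halfTwist i p (clock t) := by
  rw [strand, strand_of_le w _ (by linarith)]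
  ring

theorem strand_cons_of_ge {n : ℕ} (i : Fin (n - 1)) (w : List (Fin (n - 1))) (p : Fin n) {t : ℝ}
    (h : 2 / 3 ≤ t) : strand (i :: w) p t = strand w (sw i p) (t - 1) := by
  rw [strand, clock_of_ge h, halfTwist_one]
  ring

theorem abs_strand_im_le {n : ℕ} (w : List (Fin (n - 1))) (p : Fin n) (t : ℝ) :
    |(strand w p t).im| ≤ 1 / 2 := by
  induction w generalizing p t with
  | nil => simp [strand]
  | cons i w ih =>
    rcases le_total t 1 with h | h
    · rw [strand_cons_of_le i w p (by linarith), halfTwist_im]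
      have h1 := Real.sin_le_one (Real.pi * clock t)
      have h2 := sin_clock_nonneg t
      rw [abs_le]
      split_ifs <;> constructor <;> linarith
    · rw [strand_cons_of_ge i w p (by linarith)]
      exact ih _ _

theorem strand_append_of_le {n : ℕ} (u v : List (Fin (n - 1))) (p : Fin n) {t : ℝ}
    (h : t ≤ u.length + 1 / 3) : strand (u ++ v) p t = strand u p t := by
  rw [strand_append, strand_of_le v _ (by linarith)]
  ring

theorem strand_append_of_ge {n : ℕ} (u v : List (Fin (n - 1))) (p : Fin n) {t : ℝ}
    (h : u.length - 1 / 3 ≤ t) :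
    strand (u ++ v) p t = strand v (wordPerm u p) (t - u.length) := by
  rw [strand_append, strand_of_ge u _ h]
  ring

/-- The strand that starts at `p` stays to the left of the one that starts at `q`. -/
def StaysLeft {n : ℕ} (w : List (Fin (n - 1))) (p q : Fin n) : Prop :=
  ∀ t, (strand w p t).re < (strand w q t).re

theorem staysLeft_nil {n : ℕ} {p q : Fin n} (h : (p : ℕ) < q) :
    StaysLeft ([] : List (Fin (n - 1))) p q := by
  intro t
  simp only [strand, Complex.natCast_re]
  exact_mod_cast h

/-- A letter changes the left-right order of no pair except the one that it exchanges. -/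
theorem staysLeft_cons {n : ℕ} {i : Fin (n - 1)} {w : List (Fin (n - 1))} {p q : Fin n}
    (hpq : (p : ℕ) < q) (h : ¬ ((p : ℕ) = i ∧ (q : ℕ) = i + 1))
    (hw : StaysLeft w (sw i p) (sw i q)) : StaysLeft (i :: w) p q := by
  intro t
  rcases le_total t 1 with ht | ht
  · rw [strand_cons_of_le i w p (by linarith), strand_cons_of_le i w q (by linarith)]
    exact halfTwist_re_lt hpq h _
  · rw [strand_cons_of_ge i w p (by linarith), strand_cons_of_ge i w q (by linarith)]
    exact hw _

theorem staysLeft_singleton {n : ℕ} {i : Fin (n - 1)} {p q : Fin n}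
    (hpq : (p : ℕ) < q) (h : ¬ ((p : ℕ) = i ∧ (q : ℕ) = i + 1)) : StaysLeft [i] p q := by
  refine staysLeft_cons hpq h (staysLeft_nil ?_)
  rw [sw_val, sw_val]
  split_ifs <;> omega

/-- Whenever two strands of the word are above one another, then the strand that starts further to
the right is the upper one. In particular, any two strands cross at most once. -/
def CrossesAbove {n : ℕ} (w : List (Fin (n - 1))) : Prop :=
  ∀ p q : Fin n, (p : ℕ) < q → ∀ t, (strand w q t - strand w p t).re = 0 →
    0 < (strand w q t - strand w p t).im

theorem crossesAbove_nil {n : ℕ} : CrossesAbove ([] : List (Fin (n - 1))) := by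
  intro p q hpq t h
  have := staysLeft_nil (n := n) hpq t
  rw [Complex.sub_re] at h
  linarith

theorem crossesAbove_cons {n : ℕ} {i : Fin (n - 1)} {w : List (Fin (n - 1))}
    (hw : CrossesAbove w) (hi : StaysLeft w ⟨i, by omega⟩ ⟨i + 1, by omega⟩) :
    CrossesAbove (i :: w) := by
  intro p q hpq t h
  rcases le_total t 1 with ht | ht
  · rw [strand_cons_of_le i w p (by linarith), strand_cons_of_le i w q (by linarith)] at h ⊢
    by_cases hc : (p : ℕ) = i ∧ (q : ℕ) = i + 1
    · have hq : (q : ℕ) ≠ i := by omega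
      have h0 := sin_clock_nonneg t
      have h1 := Real.sin_sq_add_cos_sq (Real.pi * clock t)
      rw [Complex.sub_re, halfTwist_re, halfTwist_re, if_pos hc.1, if_neg hq, if_pos hc.2] at h
      rw [Complex.sub_im, halfTwist_im, halfTwist_im, if_pos hc.1, if_neg hq, if_pos hc.2]
      have h2 : Real.cos (Real.pi * clock t) = 0 := by linarith
      rw [h2] at h1
      nlinarith
    · have := halfTwist_re_lt hpq hc (clock t)
      rw [Complex.sub_re] at h
      linarith
  · rw [strand_cons_of_ge i w p (by linarith), strand_cons_of_ge i w q (by linarith)] at h ⊢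
    by_cases hc : (p : ℕ) = i ∧ (q : ℕ) = i + 1
    · have hp' : sw i p = ⟨i + 1, by omega⟩ := Fin.ext (by rw [sw_val]; simp [hc.1])
      have hq' : sw i q = ⟨i, by omega⟩ := Fin.ext (by rw [sw_val]; simp [hc.2])
      rw [hp', hq', Complex.sub_re] at h
      have := hi (t - 1)
      linarith
    · refine hw _ _ ?_ _ h
      rw [sw_val, sw_val]
      split_ifs <;> omega

/-! ### Exchanging permutation braids with the same permutation -/

/-- A smooth function, `1` on `[1/3, l - 1/3]` and `0` outside `[1/6, l - 1/6]`. -/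
def plateau (l t : ℝ) : ℝ :=
  Real.smoothTransition (6 * t - 1) * Real.smoothTransition (6 * (l - t) - 1)

theorem plateau_nonneg (l t : ℝ) : 0 ≤ plateau l t :=
  mul_nonneg (Real.smoothTransition.nonneg _) (Real.smoothTransition.nonneg _)

theorem plateau_eq_one {l t : ℝ} (h1 : 1 / 3 ≤ t) (h2 : t ≤ l - 1 / 3) : plateau l t = 1 := by
  rw [plateau, Real.smoothTransition.one_of_one_le (by linarith),
    Real.smoothTransition.one_of_one_le (by linarith), one_mul]

theorem plateau_eq_zero_of_le {l t : ℝ} (h : t ≤ 1 / 6) : plateau l t = 0 := by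
  rw [plateau, Real.smoothTransition.zero_of_nonpos (by linarith), zero_mul]

theorem plateau_eq_zero_of_ge {l t : ℝ} (h : l - 1 / 6 ≤ t) : plateau l t = 0 := by
  rw [plateau, Real.smoothTransition.zero_of_nonpos (x := 6 * (l - t) - 1) (by linarith), mul_zero]

theorem contDiff_plateau (l : ℝ) : ContDiff ℝ ∞ (plateau l) :=
  (Real.smoothTransition.contDiff.comp (by fun_prop)).mul
    (Real.smoothTransition.contDiff.comp (by fun_prop))

/-- The strands of `u ++ y`, pushed apart vertically while `u` is executed. -/
def pushedStrand {n : ℕ} (u y : List (Fin (n - 1))) (p : Fin n) (t : ℝ) : ℂ :=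
  strand (u ++ y) p t + (2 * plateau u.length t * p : ℝ) * Complex.I

/-- Where real parts agree, the strand starting further right is already above, and pushing only
widens the gap. Past `u` the push is switched off. A variable factor `c` serves both the pushed
braid and the homotopy leading to it. -/
theorem pushed_ne {n : ℕ} {u : List (Fin (n - 1))} (hu : CrossesAbove u)
    (y : List (Fin (n - 1))) {p q : Fin n} (hpq : p ≠ q) (t : ℝ) {c : ℝ} (hc : 0 ≤ c) :
    strand (u ++ y) p t - strand (u ++ y) q t +
      (c * plateau u.length t * (p - q) : ℝ) * Complex.I ≠ 0 := by
  have key : ∀ p q : Fin n, (p : ℕ) < q → strand (u ++ y) q t - strand (u ++ y) p t +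
      (c * plateau u.length t * (q - p) : ℝ) * Complex.I ≠ 0 := by
    intro p q hpq h0
    rcases le_total t u.length with ht | ht
    · rw [strand_append_of_le u y p (by linarith), strand_append_of_le u y q (by linarith)] at h0
      have hre := congrArg Complex.re h0
      have him := congrArg Complex.im h0
      simp only [Complex.add_re, Complex.add_im, Complex.re_ofReal_mul, Complex.im_ofReal_mul,
        Complex.I_re, Complex.I_im, mul_zero, mul_one, add_zero, Complex.zero_re,
        Complex.zero_im] at hre him
      have h1 := hu p q hpq t hre
      have h2 : (p : ℝ) ≤ q := by exact_mod_cast hpq.le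
      have h3 : 0 ≤ c * plateau u.length t * ((q : ℝ) - p) :=
        mul_nonneg (mul_nonneg hc (plateau_nonneg _ _)) (by linarith)
      linarith
    · rw [plateau_eq_zero_of_ge (by linarith)] at h0
      have hne : q ≠ p := fun h => by rw [h] at hpq; exact lt_irrefl _ hpq
      exact sub_ne_zero.2 (strand_ne (u ++ y) hne t) (by simpa using h0)
  rcases lt_or_gt_of_ne (fun h => hpq (Fin.ext h) : (p : ℕ) ≠ q) with h | h
  · intro h0
    apply key p q h
    push_cast at h0 ⊢
    linear_combination -h0
  · exact key q p h

theorem isClosedBraid_pushed {n : ℕ} {u : List (Fin (n - 1))} (hu : CrossesAbove u)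
    (y : List (Fin (n - 1))) :
    IsClosedBraid (wordPerm (u ++ y))
      (periodize (wordPerm (u ++ y)) fun p s => pushedStrand u y p ((u ++ y).length * s)) := by
  set L : ℝ := ((u ++ y).length : ℝ) with hL
  have hL0 : 0 ≤ L := Nat.cast_nonneg _
  have hLu : (u.length : ℝ) ≤ L := by
    rw [hL, List.length_append]
    push_cast
    linarith [(Nat.cast_nonneg y.length : (0 : ℝ) ≤ y.length)]
  refine ⟨?_, periodize_add_one _ _, ?_⟩
  · refine contDiff_periodize (ε := 1 / (6 * (L + 1))) (by positivity) ?_ ?_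
    · intro p
      have h1 : ContDiff ℝ ∞ fun s : ℝ => L * s := by fun_prop
      have h2 : ContDiff ℝ ∞ fun t : ℝ => ((2 * plateau u.length t * p : ℝ) : ℂ) :=
        Complex.ofRealCLM.contDiff.comp
          ((contDiff_const.mul (contDiff_plateau _)).mul contDiff_const)
      exact ((contDiff_strand (u ++ y) p).add (h2.mul contDiff_const)).comp h1
    · intro p s h1 h2
      have h3 : -(1 / 6) < L * s := by
        have h4 : (6 * (L + 1)) * (1 / (6 * (L + 1))) = 1 := mul_one_div_cancel (by positivity)
        nlinarith
      have h5 : L * s ≤ 0 := mul_nonpos_of_nonneg_of_nonpos hL0 h2.le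
      simp only [pushedStrand]
      rw [plateau_eq_zero_of_ge (t := L * (s + 1)) (by nlinarith),
        plateau_eq_zero_of_le (t := L * s) (by linarith), strand_of_ge _ _ (by nlinarith),
        strand_of_le _ _ (by linarith)]
      simp
  · intro p q s hpq h
    unfold periodize at h
    refine pushed_ne hu y (fun hh => hpq ((wordPerm (u ++ y) ^ ⌊s⌋).injective hh))
      (L * Int.fract s) (c := 2) (by norm_num) ?_
    simp only [pushedStrand] at h
    push_cast at h ⊢
    linear_combination h

theorem isotopic_closure_pushed {n : ℕ} {u : List (Fin (n - 1))} (hu : CrossesAbove u)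
    (y : List (Fin (n - 1))) :
    Isotopic (closure (u ++ y)) (braidLink (isClosedBraid_pushed hu y)) := by
  rw [closure_eq_braidLink]
  refine isotopic_of_smooth (smoothIsotopy_of_linear _ _ ?_)
  intro p q s hs hpq τ hτ h
  rw [periodize_of_mem _ _ _ hs, periodize_of_mem _ _ _ hs] at h
  have hc : ∀ p, closedStrand (u ++ y) p s = strand (u ++ y) p ((u ++ y).length * s) :=
    fun p => periodize_of_mem (wordPerm (u ++ y))
      (fun p s => strand (u ++ y) p ((u ++ y).length * s)) p hs
  rw [hc, hc] at h
  refine pushed_ne hu y hpq ((u ++ y).length * s) (c := 2 * τ) (by linarith [hτ.1]) ?_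
  simp only [pushedStrand] at h
  push_cast at h ⊢
  linear_combination h

/-- Pushed strands have height offsets at least 2 apart, whereas the unpushed heights of two strands
differ by at most 1. Hence on the plateau the vertical order is the same in both braids and a
straight line joins them. Off the plateau the two words already give the same strands, by equality
of permutations. -/
theorem isotopic_closure_of_crossesAbove {n : ℕ} {u v : List (Fin (n - 1))}
    (hu : CrossesAbove u) (hv : CrossesAbove v) (hl : u.length = v.length)
    (hπ : wordPerm u = wordPerm v) (y : List (Fin (n - 1))) :
    Isotopic (closure (u ++ y)) (closure (v ++ y)) := by
  refine (isotopic_closure_pushed hu y).trans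
    (Isotopic.trans (isotopic_of_smooth ?_) (isotopic_closure_pushed hv y).symm)
  have hπ' : wordPerm (u ++ y) = wordPerm (v ++ y) := by
    rw [wordPerm_append, wordPerm_append, hπ]
  have hl' : (u ++ y).length = (v ++ y).length := by simp [hl]
  have hb := isClosedBraid_pushed hv y
  rw [← hπ', ← hl'] at hb
  have hlink : braidLink (isClosedBraid_pushed hv y) = braidLink hb := by
    simp only [braidLink, coneLink, hπ', hl']
  rw [hlink]
  refine smoothIsotopy_of_linear _ _ ?_
  intro p q s hs hpq τ hτ h
  simp only [periodize_of_mem _ _ _ hs] at h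
  set t : ℝ := ((u ++ y).length : ℝ) * s
  have hcase : (∀ p, strand (u ++ y) p t = strand (v ++ y) p t) ∨
      (1 / 3 ≤ t ∧ t ≤ u.length - 1 / 3) := by
    rcases le_total t (1 / 3) with h1 | h1
    · exact Or.inl fun p => by rw [strand_of_le _ _ h1, strand_of_le _ _ h1]
    rcases le_total t (u.length - 1 / 3) with h2 | h2
    · exact Or.inr ⟨h1, h2⟩
    · refine Or.inl fun p => ?_
      rw [strand_append_of_ge u y p h2, strand_append_of_ge v y p (by rw [← hl]; exact h2), hπ, hl]
  rcases hcase with hc | ⟨h1, h2⟩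
  · refine pushed_ne hu y hpq t (c := 2) (by norm_num) ?_
    simp only [pushedStrand, ← hc, ← hl] at h
    push_cast at h ⊢
    linear_combination h
  · simp only [pushedStrand, ← hl] at h
    rw [plateau_eq_one h1 h2] at h
    have him := congrArg Complex.im h
    simp only [Complex.add_im, Complex.sub_im, Complex.im_ofReal_mul, Complex.I_im,
      mul_one, Complex.zero_im, ← Complex.ofReal_one, ← Complex.ofReal_sub] at him
    have b1 := abs_le.1 (abs_strand_im_le (u ++ y) p t)
    have b2 := abs_le.1 (abs_strand_im_le (u ++ y) q t)
    have b3 := abs_le.1 (abs_strand_im_le (v ++ y) p t)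
    have b4 := abs_le.1 (abs_strand_im_le (v ++ y) q t)
    obtain ⟨hτ0, hτ1⟩ := hτ
    rcases lt_or_gt_of_ne (fun h => hpq (Fin.ext h) : (p : ℕ) ≠ q) with hlt | hlt
    · have : (p : ℝ) + 1 ≤ q := by exact_mod_cast hlt
      nlinarith
    · have : (q : ℝ) + 1 ≤ p := by exact_mod_cast hlt
      nlinarith

theorem isotopic_closure_exchange {n : ℕ} {u v : List (Fin (n - 1))}
    (hu : CrossesAbove u) (hv : CrossesAbove v) (hl : u.length = v.length)
    (hπ : wordPerm u = wordPerm v) (x y : List (Fin (n - 1))) :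
    Isotopic (closure (x ++ u ++ y)) (closure (x ++ v ++ y)) := by
  have h1 := isotopic_closure_rotate x (u ++ y)
  have h2 := isotopic_closure_of_crossesAbove hu hv hl hπ (y ++ x)
  have h3 := isotopic_closure_rotate (v ++ y) x
  simp only [List.append_assoc] at *
  exact h1.trans (h2.trans h3)

theorem isotopic_closure_comm {n : ℕ} {i j : Fin (n - 1)} (hij : (i : ℕ) + 2 ≤ j)
    (x y : List (Fin (n - 1))) :
    Isotopic (closure (x ++ [i, j] ++ y)) (closure (x ++ [j, i] ++ y)) := by
  refine isotopic_closure_exchange ?_ ?_ (by simp) ?_ x y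
  · exact crossesAbove_cons (crossesAbove_cons crossesAbove_nil (staysLeft_nil (by simp)))
      (staysLeft_singleton (by simp) (by simp; omega))
  · exact crossesAbove_cons (crossesAbove_cons crossesAbove_nil (staysLeft_nil (by simp)))
      (staysLeft_singleton (by simp) (by simp; omega))
  · ext p
    simp only [wordPerm, one_mul, Equiv.Perm.mul_apply, sw_val]
    split_ifs <;> omega

/-- In either side of the relation each of the three pairs of moving strands crosses exactly once.
-/
theorem isotopic_closure_braid {n : ℕ} {i j : Fin (n - 1)} (hij : (i : ℕ) + 1 = j)
    (x y : List (Fin (n - 1))) :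
    Isotopic (closure (x ++ [i, j, i] ++ y)) (closure (x ++ [j, i, j] ++ y)) := by
  refine isotopic_closure_exchange ?_ ?_ (by simp) ?_ x y
  · refine crossesAbove_cons (crossesAbove_cons
      (crossesAbove_cons crossesAbove_nil (staysLeft_nil (by simp)))
      (staysLeft_singleton (by simp) (by simp; omega)))
      (staysLeft_cons (by simp) (by simp; omega) (staysLeft_singleton ?_ ?_)) <;>
    simp only [sw_val] <;> split_ifs <;> omega
  · refine crossesAbove_cons (crossesAbove_cons
      (crossesAbove_cons crossesAbove_nil (staysLeft_nil (by simp)))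
      (staysLeft_singleton (by simp) (by simp; omega)))
      (staysLeft_cons (by simp) (by simp; omega) (staysLeft_singleton ?_ ?_)) <;>
    simp only [sw_val] <;> split_ifs <;> omega
  · have ha : sw i = Equiv.swap (⟨i, by omega⟩ : Fin n) ⟨i + 1, by omega⟩ := rfl
    have hb : sw j = Equiv.swap (⟨i + 1, by omega⟩ : Fin n) ⟨i + 2, by omega⟩ := by
      simp only [sw, ← hij]
    -- Both products are the transposition of the positions i and i + 2.
    simp only [wordPerm, one_mul, ha, hb]
    rw [Equiv.swap_mul_swap_mul_swap (by simp) (by simp),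
      Equiv.swap_comm (⟨i, by omega⟩ : Fin n) ⟨i + 1, by omega⟩,
      Equiv.swap_comm (⟨i + 1, by omega⟩ : Fin n) ⟨i + 2, by omega⟩,
      Equiv.swap_mul_swap_mul_swap (by simp) (by simp), Equiv.swap_comm]

/-! ### Adding a strand to a braid word -/

/-- The word `w`, regarded as a word in the generators for one more strand. -/
def liftWord {n : ℕ} (w : List (Fin (n - 1))) : List (Fin (n + 1 - 1)) :=
  w.map fun i : Fin (n - 1) => ⟨i, by have := i.isLt; omega⟩

theorem sw_lift_castSucc {n : ℕ} (i : Fin (n - 1)) (p : Fin n) :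
    sw (n := n + 1) ⟨i, by omega⟩ p.castSucc = (sw i p).castSucc := by
  ext
  simp only [sw_val, Fin.val_castSucc]

theorem sw_lift_last {n : ℕ} (i : Fin (n - 1)) :
    sw (n := n + 1) ⟨i, by omega⟩ (Fin.last n) = Fin.last n := by
  ext
  simp only [sw_val, Fin.val_last]
  split_ifs <;> omega

theorem strand_lift_castSucc {n : ℕ} (w : List (Fin (n - 1))) (p : Fin n) (t : ℝ) :
    strand (liftWord w) p.castSucc t = strand w p t := by
  induction w generalizing p t with
  | nil => rfl
  | cons i w ih =>
    simp only [liftWord, List.map_cons, strand, sw_lift_castSucc] at ih ⊢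
    rw [ih]
    rfl

theorem strand_lift_last {n : ℕ} (w : List (Fin (n - 1))) (t : ℝ) :
    strand (liftWord w) (Fin.last n) t = n := by
  induction w generalizing t with
  | nil => simp [liftWord, strand]
  | cons i w ih =>
    simp only [liftWord, List.map_cons, strand, sw_lift_last] at ih ⊢
    rw [ih]
    have h1 : ¬ n = (i : ℕ) := by omega
    have h2 : ¬ n = (i : ℕ) + 1 := by omega
    simp [halfTwist, h1, h2]

theorem wordPerm_lift_castSucc {n : ℕ} (w : List (Fin (n - 1))) (p : Fin n) :
    wordPerm (liftWord w) p.castSucc = (wordPerm w p).castSucc := by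
  induction w generalizing p with
  | nil => rfl
  | cons i w ih =>
    simp only [liftWord, List.map_cons, wordPerm, Equiv.Perm.mul_apply, sw_lift_castSucc] at ih ⊢
    rw [ih]

theorem wordPerm_lift_last {n : ℕ} (w : List (Fin (n - 1))) :
    wordPerm (liftWord w) (Fin.last n) = Fin.last n := by
  induction w with
  | nil => rfl
  | cons i w ih =>
    simp only [liftWord, List.map_cons, wordPerm, Equiv.Perm.mul_apply, sw_lift_last] at ih ⊢
    rw [ih]

theorem strand_re_le {n : ℕ} (w : List (Fin (n - 1))) (p : Fin n) (t : ℝ) :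
    (strand w p t).re ≤ n - 1 := by
  have hp : ∀ p : Fin n, (p : ℝ) ≤ n - 1 := fun p => by
    have : (p : ℝ) + 1 ≤ n := by exact_mod_cast p.isLt
    linarith
  induction w generalizing p t with
  | nil => simpa [strand] using hp p
  | cons i w ih =>
    rcases le_total t 1 with h | h
    · rw [strand_cons_of_le i w p (by linarith), halfTwist_re]
      have h1 := Real.cos_le_one (Real.pi * clock t)
      have h2 := Real.neg_one_le_cos (Real.pi * clock t)
      have h3 : (i : ℝ) + 1 ≤ n - 1 := by simpa using hp ⟨i + 1, by omega⟩
      split_ifs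
      · linarith
      · linarith
      · exact hp p
    · rw [strand_cons_of_ge i w p (by linarith)]
      exact ih _ _

/-- The word `w` followed by the last generator for one more strand. -/
def stabWord {n : ℕ} (hn : 0 < n) (w : List (Fin (n - 1))) : List (Fin (n + 1 - 1)) :=
  liftWord w ++ [⟨n - 1, by omega⟩]

theorem length_liftWord {n : ℕ} (w : List (Fin (n - 1))) : (liftWord w).length = w.length := by
  simp [liftWord]

/-- The starting position of the strand of `w` that ends at the last position. -/
def outermost {n : ℕ} (hn : 0 < n) (w : List (Fin (n - 1))) : Fin n :=
  (wordPerm w).symm ⟨n - 1, by omega⟩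

theorem wordPerm_outermost {n : ℕ} (hn : 0 < n) (w : List (Fin (n - 1))) :
    wordPerm w (outermost hn w) = ⟨n - 1, by omega⟩ :=
  Equiv.apply_symm_apply _ _

theorem wordPerm_val_lt {n : ℕ} (hn : 0 < n) (w : List (Fin (n - 1))) {q : Fin n}
    (hq : q ≠ outermost hn w) : ((wordPerm w q : Fin n) : ℕ) + 1 < n := by
  by_contra h
  apply hq
  rw [outermost, Equiv.eq_symm_apply]
  ext
  simp only
  omega

theorem wordPerm_stab {n : ℕ} (hn : 0 < n) (w : List (Fin (n - 1))) {q : Fin n}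
    (hq : q ≠ outermost hn w) : wordPerm (stabWord hn w) q.castSucc = (wordPerm w q).castSucc := by
  have := wordPerm_val_lt hn w hq
  rw [stabWord, wordPerm_append, Equiv.Perm.mul_apply, wordPerm_lift_castSucc]
  ext
  simp only [wordPerm, one_mul, sw_val, Fin.val_castSucc]
  split_ifs <;> omega

theorem wordPerm_stab_outermost {n : ℕ} (hn : 0 < n) (w : List (Fin (n - 1))) :
    wordPerm (stabWord hn w) (outermost hn w).castSucc = Fin.last n := by
  rw [stabWord, wordPerm_append, Equiv.Perm.mul_apply, wordPerm_lift_castSucc, wordPerm_outermost]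
  ext
  simp only [wordPerm, one_mul, sw_val, Fin.val_castSucc, Fin.val_last, if_true]
  omega

theorem wordPerm_stab_last {n : ℕ} (hn : 0 < n) (w : List (Fin (n - 1))) :
    wordPerm (stabWord hn w) (Fin.last n) = (⟨n - 1, by omega⟩ : Fin n).castSucc := by
  rw [stabWord, wordPerm_append, Equiv.Perm.mul_apply, wordPerm_lift_last]
  ext
  simp only [wordPerm, one_mul, sw_val, Fin.val_castSucc, Fin.val_last]
  split_ifs <;> omega

/-! ### Auxiliary functions

For a word of length `l` that is followed by one further letter, the last letter is executed while
`s` runs through `[l / (l + 1), 1]`. -/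

/-- Increases from `0` to `1` before the first third of the last letter. -/
def rampUp (l s : ℝ) : ℝ := Real.smoothTransition (3 * ((l + 1) * s - l))

/-- Decreases from `1` to `0` after the second third of the last letter. -/
def rampDown (l s : ℝ) : ℝ := Real.smoothTransition (6 * (l + 1 - (l + 1) * s) - 1)

/-- Increases from `0` to `1` during the second third of the last letter. -/
def spin (l s : ℝ) : ℝ := clock ((l + 1) * s - l)

/-- An affine function that changes its sign between `1` and `1 + l / (l + 1)`. -/
def height (l x : ℝ) : ℝ := x - 1 - l / (2 * (l + 1))

theorem rampUp_mem (l s : ℝ) : rampUp l s ∈ Set.Icc (0 : ℝ) 1 :=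
  ⟨Real.smoothTransition.nonneg _, Real.smoothTransition.le_one _⟩

theorem rampDown_mem (l s : ℝ) : rampDown l s ∈ Set.Icc (0 : ℝ) 1 :=
  ⟨Real.smoothTransition.nonneg _, Real.smoothTransition.le_one _⟩

theorem spin_mem (l s : ℝ) : spin l s ∈ Set.Icc (0 : ℝ) 1 := clock_mem _

theorem rampUp_eq_zero {l s : ℝ} (h : (l + 1) * s ≤ l) : rampUp l s = 0 :=
  Real.smoothTransition.zero_of_nonpos (by linarith)

theorem rampUp_eq_one {l s : ℝ} (h : l + 1 / 3 ≤ (l + 1) * s) : rampUp l s = 1 :=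
  Real.smoothTransition.one_of_one_le (by linarith)

theorem rampDown_eq_zero {l s : ℝ} (h : l + 5 / 6 ≤ (l + 1) * s) : rampDown l s = 0 :=
  Real.smoothTransition.zero_of_nonpos (by linarith)

theorem rampDown_eq_one {l s : ℝ} (h : (l + 1) * s ≤ l + 2 / 3) : rampDown l s = 1 :=
  Real.smoothTransition.one_of_one_le (by linarith)

theorem spin_eq_zero {l s : ℝ} (h : (l + 1) * s ≤ l + 1 / 3) : spin l s = 0 :=
  clock_of_le (by linarith)

theorem spin_eq_one {l s : ℝ} (h : l + 2 / 3 ≤ (l + 1) * s) : spin l s = 1 :=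
  clock_of_ge (by linarith)

theorem contDiff_rampUp (l : ℝ) : ContDiff ℝ ∞ (rampUp l) :=
  Real.smoothTransition.contDiff.comp (by fun_prop)

theorem contDiff_rampDown (l : ℝ) : ContDiff ℝ ∞ (rampDown l) :=
  Real.smoothTransition.contDiff.comp (by fun_prop)

theorem contDiff_clock : ContDiff ℝ ∞ clock :=
  Real.smoothTransition.contDiff.comp (by fun_prop)

theorem contDiff_spin (l : ℝ) : ContDiff ℝ ∞ (spin l) := contDiff_clock.comp (by fun_prop)

theorem spin_monotone {l : ℝ} (hl : 0 ≤ l) : Monotone (spin l) := by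
  intro x y h
  refine Real.smoothTransition.monotone ?_
  have : (l + 1) * x ≤ (l + 1) * y := mul_le_mul_of_nonneg_left h (by linarith)
  linarith

theorem height_neg {l s : ℝ} (hl : 0 < l) (hs : s ≤ 1) : height l s < 0 := by
  have : 0 < l / (2 * (l + 1)) := by positivity
  unfold height
  linarith

theorem height_pos {l s : ℝ} (hl : 0 < l) (hs : l ≤ (l + 1) * s) : 0 < height l (s + 1) := by
  have h1 : l / (2 * (l + 1)) = l / (l + 1) / 2 := by
    field_simp
  have h2 : l / (l + 1) ≤ s := by
    rw [div_le_iff₀ (by positivity)]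
    linarith
  have h3 : 0 < l / (l + 1) := by positivity
  unfold height
  linarith

/-! ### The straight-line homotopies -/

/-- The segment from `d₀` to `d₁` avoids the origin, for one of several simple reasons. -/
def Compatible (d₀ d₁ : ℂ) : Prop :=
  (d₁ = d₀ ∧ d₀ ≠ 0) ∨ (0 < d₀.re ∧ 0 < d₁.re) ∨ (d₀.re < 0 ∧ d₁.re < 0) ∨
    (d₀.im ≤ 0 ∧ d₁.im < 0) ∨ (0 ≤ d₀.im ∧ 0 < d₁.im)

theorem Compatible.neg {d₀ d₁ : ℂ} (h : Compatible d₀ d₁) : Compatible (-d₀) (-d₁) := by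
  unfold Compatible at *
  simp only [Complex.neg_re, Complex.neg_im, neg_inj, neg_ne_zero, Left.neg_pos_iff,
    Left.neg_neg_iff, Left.neg_nonpos_iff, Left.nonneg_neg_iff]
  tauto

theorem Compatible.ne_zero {d₀ d₁ : ℂ} (h : Compatible d₀ d₁) {τ : ℝ} (h0 : 0 < τ) (h1 : τ ≤ 1) :
    (1 - τ) * d₀ + τ * d₁ ≠ 0 := by
  intro heq
  have hre := congrArg Complex.re heq
  have him := congrArg Complex.im heq
  simp only [← Complex.ofReal_one, ← Complex.ofReal_sub, Complex.add_re, Complex.add_im,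
    Complex.re_ofReal_mul, Complex.im_ofReal_mul, Complex.zero_re, Complex.zero_im] at hre him
  rcases h with ⟨h, hne⟩ | ⟨h, h'⟩ | ⟨h, h'⟩ | ⟨h, h'⟩ | ⟨h, h'⟩
  · rw [h] at heq
    exact hne (by linear_combination heq)
  · nlinarith [mul_pos h0 h', mul_nonneg (sub_nonneg.2 h1) h.le]
  · nlinarith [mul_pos_of_neg_of_neg (neg_lt_zero.2 h0) h',
      mul_nonneg (sub_nonneg.2 h1) (neg_nonneg.2 h.le)]
  · nlinarith [mul_pos_of_neg_of_neg (neg_lt_zero.2 h0) h',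
      mul_nonneg (sub_nonneg.2 h1) (neg_nonneg.2 h)]
  · nlinarith [mul_pos h0 h', mul_nonneg (sub_nonneg.2 h1) h]

/-- Compatibility also excludes collisions at the final parameter 1, so the target `f` is a closed
braid without a separate check. -/
theorem isotopic_of_compatible {n : ℕ} {π : Equiv.Perm (Fin n)} {z : Fin n → ℝ → ℂ}
    {f g : Fin n → ℝ → ℂ} (hz : IsClosedBraid π z) (hg : ∀ p, ∀ s ∈ Set.Ico (0 : ℝ) 1, z p s = g p s)
    {ε : ℝ} (hε : 0 < ε) (hf : ∀ p, ContDiff ℝ ∞ (f p))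
    (hper : ∀ p s, -ε < s → s < 0 → f p (s + 1) = f (π p) s)
    (h : ∀ p q s, s ∈ Set.Ico (0 : ℝ) 1 → p ≠ q → Compatible (g p s - g q s) (f p s - f q s)) :
    ∃ hf' : IsClosedBraid π (periodize π f), Isotopic (braidLink hz) (braidLink hf') := by
  have hne : ∀ p q s, p ≠ q → periodize π f p s ≠ periodize π f q s := by
    intro p q s hpq heq
    have := h _ _ (Int.fract s) ⟨Int.fract_nonneg s, Int.fract_lt_one s⟩
      (fun hh => hpq ((π ^ ⌊s⌋).injective hh))
    refine this.ne_zero one_pos le_rfl ?_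
    have h2 : f ((π ^ ⌊s⌋) p) (Int.fract s) = f ((π ^ ⌊s⌋) q) (Int.fract s) := heq
    rw [h2]
    simp
  refine ⟨⟨contDiff_periodize hε hf hper, periodize_add_one _ _, hne⟩,
    isotopic_of_smooth (smoothIsotopy_of_linear _ _ ?_)⟩
  intro p q s hs hpq τ hτ
  rw [periodize_of_mem _ _ _ hs, periodize_of_mem _ _ _ hs, hg p s hs, hg q s hs]
  exact (h p q s hs hpq).ne_zero hτ.1 hτ.2.le

/-- The strands of `w`, executed a bit faster than in the closure of `w`. -/
theorem isotopic_closure_base {n : ℕ} (w : List (Fin (n - 1))) :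
    ∃ h : IsClosedBraid (wordPerm w)
        (periodize (wordPerm w) fun p s => strand w p (((w.length : ℝ) + 1) * s)),
      Isotopic (closure w) (braidLink h) := by
  set l : ℝ := (w.length : ℝ) with hl
  have hl0 : 0 ≤ l := Nat.cast_nonneg _
  -- The speed runs from l to l + 1 through l + τ². The square keeps it at least l for all real τ,
  -- as needed for the word to be finished within one period.
  have hs : ∀ p, ContDiff ℝ ∞ fun x : ℝ × ℝ =>
      periodize (wordPerm w) (fun p s => strand w p ((l + x.1 ^ 2) * s)) p x.2 := by
    refine contDiff_periodize₂ (f := fun τ p s => strand w p ((l + τ ^ 2) * s))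
      (ε := 1 / (3 * (l + 1))) (by positivity) ?_ ?_
    · exact fun p => (contDiff_strand w p).comp (by fun_prop)
    · intro τ p s h1 h2
      have h4 : (3 * (l + 1)) * (1 / (3 * (l + 1))) = 1 := mul_one_div_cancel (by positivity)
      have h5 : -(1 / 3) < l * s := by nlinarith
      have h6 : 1 / (3 * (l + 1)) ≤ 1 := by
        rw [div_le_one (by positivity)]
        linarith
      have h7 : 0 ≤ τ ^ 2 * (s + 1) := mul_nonneg (sq_nonneg τ) (by linarith)
      have h8 : (l + τ ^ 2) * s ≤ 0 :=
        mul_nonpos_of_nonneg_of_nonpos (by positivity) h2.le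
      rw [strand_of_ge w p (by nlinarith), strand_of_le w _ (by linarith)]
  have hne : ∀ τ : ℝ, ∀ p q s, p ≠ q →
      periodize (wordPerm w) (fun p s => strand w p ((l + τ ^ 2) * s)) p s ≠
        periodize (wordPerm w) (fun p s => strand w p ((l + τ ^ 2) * s)) q s :=
    fun τ p q s hpq => strand_ne w (fun hh => hpq ((wordPerm w ^ ⌊s⌋).injective hh)) _
  have h1 : IsClosedBraid (wordPerm w)
      (periodize (wordPerm w) fun p s => strand w p ((l + 1) * s)) := by
    refine ⟨fun p => ?_, periodize_add_one _ _, by simpa using hne 1⟩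
    simpa [Function.comp_def] using
      (hs p).comp (contDiff_const (c := (1 : ℝ)) |>.prodMk contDiff_id)
  refine ⟨h1, isotopic_of_smooth ?_⟩
  rw [closure_eq_braidLink]
  refine smoothIsotopy_braidLink
    (H := fun τ => periodize (wordPerm w) fun p s => strand w p ((l + τ ^ 2) * s)) hs
    (fun τ => periodize_add_one _ _) (fun τ _ => hne τ) _ _ ?_ ?_
  · funext p s
    simp [periodize, closedStrand, hl]
  · simp

/-- The strands of `w`, where the outermost strand moves along a loop once `w` is executed. -/
def loopStrand {n : ℕ} (hn : 0 < n) (w : List (Fin (n - 1))) (q : Fin n) (s : ℝ) : ℂ :=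
  strand w q ((w.length + 1) * s) + if q = outermost hn w then
    (rampUp w.length s * rampDown w.length s : ℝ) *
      (1 + (height w.length (s + spin w.length s) : ℝ) * Complex.I) else 0

theorem contDiff_loopStrand {n : ℕ} (hn : 0 < n) (w : List (Fin (n - 1))) (q : Fin n) :
    ContDiff ℝ ∞ (loopStrand hn w q) := by
  have h1 : ContDiff ℝ ∞ fun s : ℝ => strand w q ((w.length + 1) * s) :=
    (contDiff_strand w q).comp (by fun_prop)
  have h2 : ContDiff ℝ ∞ fun s => ((rampUp w.length s * rampDown w.length s : ℝ) : ℂ) :=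
    Complex.ofRealCLM.contDiff.comp ((contDiff_rampUp _).mul (contDiff_rampDown _))
  have h3 : ContDiff ℝ ∞ fun s => ((height w.length (s + spin w.length s) : ℝ) : ℂ) :=
    Complex.ofRealCLM.contDiff.comp
      (((contDiff_id.add (contDiff_spin _)).sub contDiff_const).sub contDiff_const)
  unfold loopStrand
  split_ifs
  · exact h1.add (h2.mul (contDiff_const.add (h3.mul contDiff_const)))
  · exact h1.add contDiff_const

theorem small_time {l s : ℝ} (hl : 0 ≤ l) (h1 : -(1 / (6 * (l + 1))) < s) :
    -(1 / 6) < (l + 1) * s := by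
  have h4 : (6 * (l + 1)) * (1 / (6 * (l + 1))) = 1 := mul_one_div_cancel (by positivity)
  nlinarith

theorem loopStrand_periodic {n : ℕ} (hn : 0 < n) (w : List (Fin (n - 1))) (q : Fin n) (s : ℝ)
    (h1 : -(1 / (6 * ((w.length : ℝ) + 1))) < s) (h2 : s < 0) :
    loopStrand hn w q (s + 1) = loopStrand hn w (wordPerm w q) s := by
  have hl : (0 : ℝ) ≤ w.length := Nat.cast_nonneg _
  have h3 := small_time hl h1
  have h4 : ((w.length : ℝ) + 1) * s ≤ 0 := mul_nonpos_of_nonneg_of_nonpos (by linarith) h2.le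
  unfold loopStrand
  rw [strand_of_ge w q (by linarith), strand_of_le w _ (by linarith),
    rampDown_eq_zero (s := s + 1) (by linarith), rampUp_eq_zero (s := s) (by linarith)]
  simp

theorem loopStrand_of_le {n : ℕ} (hn : 0 < n) (w : List (Fin (n - 1))) (q : Fin n) {s : ℝ}
    (h : ((w.length : ℝ) + 1) * s ≤ w.length) :
    loopStrand hn w q s = strand w q ((w.length + 1) * s) := by
  simp [loopStrand, rampUp_eq_zero h]

theorem loopStrand_of_ne {n : ℕ} (hn : 0 < n) (w : List (Fin (n - 1))) {q : Fin n}
    (hq : q ≠ outermost hn w) (s : ℝ) :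
    loopStrand hn w q s = strand w q ((w.length + 1) * s) := by
  simp [loopStrand, hq]

theorem loopStrand_outermost {n : ℕ} (hn : 0 < n) (w : List (Fin (n - 1))) {s : ℝ}
    (h : (w.length : ℝ) - 1 / 3 ≤ (w.length + 1) * s) :
    loopStrand hn w (outermost hn w) s = (n - 1 : ℝ) + (rampUp w.length s * rampDown w.length s : ℝ) *
      (1 + (height w.length (s + spin w.length s) : ℝ) * Complex.I) := by
  rw [loopStrand, if_pos rfl, strand_of_ge w _ h, wordPerm_outermost]
  push_cast [Nat.cast_pred hn]
  rfl

theorem strand_re_le_of_ne {n : ℕ} (hn : 0 < n) (w : List (Fin (n - 1))) {q : Fin n}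
    (hq : q ≠ outermost hn w) {t : ℝ} (h : (w.length : ℝ) - 1 / 3 ≤ t) :
    (strand w q t).re ≤ n - 2 := by
  rw [strand_of_ge w _ h, Complex.natCast_re]
  have : ((wordPerm w q : Fin n) : ℝ) + 1 + 1 ≤ n := by exact_mod_cast wordPerm_val_lt hn w hq
  linarith

/-- Once `w` is executed, the outermost strand rests at n - 1 and all others at most at n - 2. The
loop only adds a nonnegative real part, so it stays to the right of them. -/
theorem isotopic_closure_loop {n : ℕ} (hn : 0 < n) (w : List (Fin (n - 1))) :
    ∃ h : IsClosedBraid (wordPerm w) (periodize (wordPerm w) (loopStrand hn w)),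
      Isotopic (closure w) (braidLink h) := by
  obtain ⟨h0, hi⟩ := isotopic_closure_base w
  have hl0 : (0 : ℝ) ≤ w.length := Nat.cast_nonneg _
  have hout : ∀ s : ℝ, ∀ q, q ≠ outermost hn w →
      Compatible (strand w (outermost hn w) ((w.length + 1) * s) - strand w q ((w.length + 1) * s))
        (loopStrand hn w (outermost hn w) s - loopStrand hn w q s) := by
    intro s q hq
    rcases le_total (((w.length : ℝ) + 1) * s) w.length with ht | ht
    · rw [loopStrand_of_le hn w _ ht, loopStrand_of_le hn w _ ht]
      exact Or.inl ⟨rfl, sub_ne_zero.2 (strand_ne w (Ne.symm hq) _)⟩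
    · refine Or.inr (Or.inl ?_)
      have h2 := strand_re_le_of_ne hn w hq (t := (w.length + 1) * s) (by linarith)
      rw [loopStrand_outermost hn w (by linarith), loopStrand_of_ne hn w hq, strand_of_ge w
        (outermost hn w) (by linarith), wordPerm_outermost]
      have h3 := mul_nonneg (rampUp_mem w.length s).1 (rampDown_mem w.length s).1
      constructor
      · rw [Complex.sub_re, Complex.natCast_re]
        simp only
        rw [Nat.cast_pred hn]
        linarith
      · rw [Complex.sub_re, Complex.add_re, Complex.ofReal_re, Complex.re_ofReal_mul]
        simp
        linarith
  have hcomp : ∀ p q s, s ∈ Set.Ico (0 : ℝ) 1 → p ≠ q →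
      Compatible (strand w p ((w.length + 1) * s) - strand w q ((w.length + 1) * s))
        (loopStrand hn w p s - loopStrand hn w q s) := by
    intro p q s _ hpq
    by_cases hp : p = outermost hn w
    · subst hp
      exact hout s q hpq.symm
    by_cases hq : q = outermost hn w
    · subst hq
      simpa using (hout s p hpq).neg
    · rw [loopStrand_of_ne hn w hp, loopStrand_of_ne hn w hq]
      exact Or.inl ⟨rfl, sub_ne_zero.2 (strand_ne w hpq _)⟩
  obtain ⟨h1, hj⟩ := isotopic_of_compatible (f := loopStrand hn w) h0
    (fun p s hs => periodize_of_mem _ _ _ hs) (ε := 1 / (6 * ((w.length : ℝ) + 1)))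
    (by positivity) (contDiff_loopStrand hn w) (loopStrand_periodic hn w) hcomp
  exact ⟨h1, hi.trans hj⟩

/-- A closed braid isotopic to the closure of `stabWord hn w`. -/
def stabStrand {n : ℕ} (hn : 0 < n) (w : List (Fin (n - 1))) (p : Fin (n + 1)) (s : ℝ) : ℂ :=
  Fin.lastCases (motive := fun _ => ℂ)
    ((n - 1 : ℝ) + (rampDown w.length s : ℝ) * (1 + (height w.length (s + 1) : ℝ) * Complex.I))
    (fun q => strand w q ((w.length + 1) * s) + if q = outermost hn w then
      (rampUp w.length s : ℝ) * (1 + (height w.length s : ℝ) * Complex.I) else 0) p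

theorem stabStrand_last {n : ℕ} (hn : 0 < n) (w : List (Fin (n - 1))) (s : ℝ) :
    stabStrand hn w (Fin.last n) s = (n - 1 : ℝ) +
      (rampDown w.length s : ℝ) * (1 + (height w.length (s + 1) : ℝ) * Complex.I) := by
  simp [stabStrand]

theorem stabStrand_castSucc {n : ℕ} (hn : 0 < n) (w : List (Fin (n - 1))) (q : Fin n) (s : ℝ) :
    stabStrand hn w q.castSucc s = strand w q ((w.length + 1) * s) + if q = outermost hn w then
      (rampUp w.length s : ℝ) * (1 + (height w.length s : ℝ) * Complex.I) else 0 := by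
  simp [stabStrand]

theorem stabStrand_of_ne {n : ℕ} (hn : 0 < n) (w : List (Fin (n - 1))) {q : Fin n}
    (hq : q ≠ outermost hn w) (s : ℝ) :
    stabStrand hn w q.castSucc s = strand w q ((w.length + 1) * s) := by
  simp [stabStrand_castSucc, hq]

theorem stabStrand_outermost {n : ℕ} (hn : 0 < n) (w : List (Fin (n - 1))) {s : ℝ}
    (h : (w.length : ℝ) - 1 / 3 ≤ (w.length + 1) * s) :
    stabStrand hn w (outermost hn w).castSucc s = (n - 1 : ℝ) +
      (rampUp w.length s : ℝ) * (1 + (height w.length s : ℝ) * Complex.I) := by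
  rw [stabStrand_castSucc, if_pos rfl, strand_of_ge w _ h, wordPerm_outermost]
  push_cast [Nat.cast_pred hn]
  rfl

theorem contDiff_stabStrand {n : ℕ} (hn : 0 < n) (w : List (Fin (n - 1))) (p : Fin (n + 1)) :
    ContDiff ℝ ∞ (stabStrand hn w p) := by
  have hh : ∀ c : ℝ, ContDiff ℝ ∞ fun s : ℝ => ((height w.length (s + c) : ℝ) : ℂ) := fun c =>
    Complex.ofRealCLM.contDiff.comp
      (((contDiff_id.add contDiff_const).sub contDiff_const).sub contDiff_const)
  induction p using Fin.lastCases with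
  | last =>
    have h2 : ContDiff ℝ ∞ fun s => ((rampDown w.length s : ℝ) : ℂ) :=
      Complex.ofRealCLM.contDiff.comp (contDiff_rampDown _)
    have : stabStrand hn w (Fin.last n) = fun s => ((n - 1 : ℝ) : ℂ) +
        (rampDown w.length s : ℝ) * (1 + (height w.length (s + 1) : ℝ) * Complex.I) :=
      funext (stabStrand_last hn w)
    rw [this]
    exact contDiff_const.add (h2.mul (contDiff_const.add ((hh 1).mul contDiff_const)))
  | cast q =>
    have h1 : ContDiff ℝ ∞ fun s : ℝ => strand w q ((w.length + 1) * s) :=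
      (contDiff_strand w q).comp (by fun_prop)
    have h2 : ContDiff ℝ ∞ fun s => ((rampUp w.length s : ℝ) : ℂ) :=
      Complex.ofRealCLM.contDiff.comp (contDiff_rampUp _)
    have h3 := hh 0
    simp only [add_zero] at h3
    rw [funext (stabStrand_castSucc hn w q)]
    split_ifs
    · exact h1.add (h2.mul (contDiff_const.add (h3.mul contDiff_const)))
    · exact h1.add contDiff_const

theorem stabStrand_periodic {n : ℕ} (hn : 0 < n) (w : List (Fin (n - 1))) (p : Fin (n + 1)) (s : ℝ)
    (h1 : -(1 / (6 * ((w.length : ℝ) + 1))) < s) (h2 : s < 0) :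
    stabStrand hn w p (s + 1) = stabStrand hn w (wordPerm (stabWord hn w) p) s := by
  have hl : (0 : ℝ) ≤ w.length := Nat.cast_nonneg _
  have h3 := small_time hl h1
  have h4 : ((w.length : ℝ) + 1) * s ≤ 0 := mul_nonpos_of_nonneg_of_nonpos (by linarith) h2.le
  have hrest : ∀ q : Fin n, stabStrand hn w q.castSucc s = (q : ℂ) := fun q => by
    rw [stabStrand_castSucc, strand_of_le w _ (by linarith), rampUp_eq_zero (by linarith)]
    simp
  induction p using Fin.lastCases with
  | last =>
    rw [wordPerm_stab_last, hrest, stabStrand_last, rampDown_eq_zero (by linarith)]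
    push_cast [Nat.cast_pred hn]
    ring
  | cast q =>
    by_cases hq : q = outermost hn w
    · rw [hq, wordPerm_stab_outermost, stabStrand_outermost hn w (by linarith), stabStrand_last,
        rampUp_eq_one (by linarith), rampDown_eq_one (by linarith)]
    · rw [wordPerm_stab hn w hq, hrest, stabStrand_of_ne hn w hq, strand_of_ge w _ (by linarith)]

/-- During the last letter the two exchanged strands remain to the right of all others. In the half
twist the former outermost strand is never above the new one, and in the model it is strictly below,
because `height` is negative on the first and positive on the second. Positivity of the length of
`w` makes these signs strict. -/
theorem isotopic_closure_stab {n : ℕ} (hn : 0 < n) {w : List (Fin (n - 1))} (hw : w ≠ []) :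
    ∃ h : IsClosedBraid (wordPerm (stabWord hn w))
        (periodize (wordPerm (stabWord hn w)) (stabStrand hn w)),
      Isotopic (closure (stabWord hn w)) (braidLink h) := by
  have hl0 : (0 : ℝ) < w.length := by exact_mod_cast List.length_pos_iff.2 hw
  have hlen : ((stabWord hn w).length : ℝ) = w.length + 1 := by simp [stabWord, liftWord]
  set g : Fin (n + 1) → ℝ → ℂ := fun p s => strand (stabWord hn w) p ((w.length + 1) * s) with hg
  rw [closure_eq_braidLink]
  refine isotopic_of_compatible (f := stabStrand hn w) (g := g)
    (isClosedBraid_closedStrand (stabWord hn w)) ?_ (ε := 1 / (6 * ((w.length : ℝ) + 1)))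
    (by positivity) (contDiff_stabStrand hn w) (stabStrand_periodic hn w) ?_
  · intro p s hs
    rw [hg, ← hlen]
    exact periodize_of_mem (wordPerm (stabWord hn w)) (fun p s => strand (stabWord hn w) p
      ((stabWord hn w).length * s)) p hs
  have g_early : ∀ q : Fin n, ∀ s : ℝ, ((w.length : ℝ) + 1) * s ≤ w.length →
      g q.castSucc s = strand w q ((w.length + 1) * s) := by
    intro q s hs
    rw [hg]
    simp only [stabWord]
    rw [strand_append_of_le _ _ _ (by rw [length_liftWord]; linarith), strand_lift_castSucc]
  have g_early_last : ∀ s : ℝ, ((w.length : ℝ) + 1) * s ≤ w.length → g (Fin.last n) s = n := by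
    intro s hs
    rw [hg]
    simp only [stabWord]
    rw [strand_append_of_le _ _ _ (by rw [length_liftWord]; linarith), strand_lift_last]
  have g_late : ∀ p : Fin (n + 1), ∀ s : ℝ, s < 1 → (w.length : ℝ) ≤ (w.length + 1) * s → g p s =
      halfTwist ⟨n - 1, by omega⟩ (wordPerm (liftWord w) p) (spin w.length s) := by
    intro p s h1 hs
    rw [hg]
    simp only [stabWord]
    rw [strand_append_of_ge _ _ _ (by rw [length_liftWord]; linarith), length_liftWord,
      strand_cons_of_le _ _ _ (by nlinarith)]
    rfl
  have hpred : ((n - 1 : ℕ) : ℝ) = n - 1 := Nat.cast_pred hn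
  have hcos : ∀ s, 0 ≤ Real.sin (Real.pi * spin w.length s) := fun s => sin_clock_nonneg _
  have g_late_ne : ∀ q : Fin n, q ≠ outermost hn w → ∀ s : ℝ, s < 1 →
      (w.length : ℝ) ≤ (w.length + 1) * s → g q.castSucc s = strand w q ((w.length + 1) * s) := by
    intro q hq s h1 hs
    have := wordPerm_val_lt hn w hq
    rw [g_late _ _ h1 hs, wordPerm_lift_castSucc, strand_of_ge w q (by linarith), halfTwist]
    simp only [Fin.val_castSucc]
    rw [if_neg (by omega), if_neg (by omega)]
  have key1 : ∀ s ∈ Set.Ico (0 : ℝ) 1, ∀ q : Fin n, q ≠ outermost hn w →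
      Compatible (g (outermost hn w).castSucc s - g q.castSucc s)
        (stabStrand hn w (outermost hn w).castSucc s - stabStrand hn w q.castSucc s) := by
    intro s hs q hq
    rw [stabStrand_of_ne hn w hq]
    rcases le_total (((w.length : ℝ) + 1) * s) w.length with ht | ht
    · rw [g_early _ _ ht, g_early _ _ ht, stabStrand_castSucc, rampUp_eq_zero ht]
      refine Or.inl ⟨by simp, sub_ne_zero.2 (strand_ne w (Ne.symm hq) _)⟩
    · refine Or.inr (Or.inl ?_)
      have h2 := strand_re_le_of_ne hn w hq (t := (w.length + 1) * s) (by linarith)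
      have h3 := Real.cos_le_one (Real.pi * spin w.length s)
      have h4 := (rampUp_mem w.length s).1
      rw [g_late_ne q hq s hs.2 ht, g_late _ _ hs.2 ht, wordPerm_lift_castSucc, wordPerm_outermost,
        Complex.sub_re, Complex.sub_re, halfTwist_re, stabStrand_outermost hn w (by linarith)]
      constructor
      · simp only [Fin.val_castSucc, if_true, hpred]
        linarith
      · rw [Complex.add_re, Complex.ofReal_re, Complex.re_ofReal_mul]
        simp
        linarith
  have key2 : ∀ s ∈ Set.Ico (0 : ℝ) 1, ∀ q : Fin n,
      Compatible (g q.castSucc s - g (Fin.last n) s)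
        (stabStrand hn w q.castSucc s - stabStrand hn w (Fin.last n) s) := by
    intro s hs q
    rcases le_total (((w.length : ℝ) + 1) * s) w.length with ht | ht
    · have h1 := strand_re_le w q ((w.length + 1) * s)
      refine Or.inr (Or.inr (Or.inl ?_))
      rw [g_early _ _ ht, g_early_last _ ht, stabStrand_castSucc, rampUp_eq_zero ht,
        stabStrand_last, rampDown_eq_one (by linarith)]
      constructor
      · rw [Complex.sub_re, Complex.natCast_re]
        linarith
      · simp
        linarith
    · have hlast : g (Fin.last n) s =
          halfTwist (n := n + 1) ⟨n - 1, by omega⟩ (Fin.last n) (spin w.length s) := by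
        rw [g_late _ _ hs.2 ht, wordPerm_lift_last]
      have hn1 : ¬ n = n - 1 := by omega
      have hn2 : n = n - 1 + 1 := by omega
      by_cases hq : q = outermost hn w
      · refine Or.inr (Or.inr (Or.inr (Or.inl ?_)))
        subst hq
        rw [hlast, g_late _ _ hs.2 ht, wordPerm_lift_castSucc, wordPerm_outermost,
          stabStrand_outermost hn w (by linarith), stabStrand_last, Complex.sub_im, halfTwist_im,
          halfTwist_im]
        have h0 := hcos s
        constructor
        · simp only [Fin.val_castSucc, Fin.val_last, if_true]
          rw [if_neg hn1, if_pos hn2]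
          linarith
        · have e : ∀ a b c d e : ℝ, (((e : ℂ) + (a : ℂ) * (1 + (b : ℂ) * Complex.I)) -
              ((e : ℂ) + (c : ℂ) * (1 + (d : ℂ) * Complex.I))).im = a * b - c * d := by
            intro a b c d e
            simp
          rw [e]
          have h1 := rampUp_mem w.length s
          have h2 := rampDown_mem w.length s
          have h3 := height_neg hl0 hs.2.le
          have h4 := height_pos hl0 ht
          have h5 : rampUp w.length s * height w.length s ≤ 0 :=
            mul_nonpos_of_nonneg_of_nonpos h1.1 h3.le
          have h6 : 0 ≤ rampDown w.length s * height w.length (s + 1) := mul_nonneg h2.1 h4.le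
          -- At every moment at least one of the two ramps equals 1, which makes the inequality
          -- strict.
          rcases le_total (((w.length : ℝ) + 1) * s) (w.length + 2 / 3) with h | h
          · rw [rampDown_eq_one h] at h6 ⊢
            linarith
          · rw [rampUp_eq_one (by linarith)] at h5 ⊢
            linarith
      · refine Or.inr (Or.inr (Or.inl ?_))
        have h2 := strand_re_le_of_ne hn w hq (t := (w.length + 1) * s) (by linarith)
        have h3 := Real.neg_one_le_cos (Real.pi * spin w.length s)
        have h4 := (rampDown_mem w.length s).1
        rw [g_late_ne q hq s hs.2 ht, hlast, stabStrand_of_ne hn w hq, stabStrand_last,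
          Complex.sub_re, Complex.sub_re, halfTwist_re]
        constructor
        · simp only [Fin.val_last]
          rw [if_neg hn1, if_pos hn2, hpred]
          linarith
        · rw [Complex.add_re, Complex.ofReal_re, Complex.re_ofReal_mul]
          simp
          linarith
  intro p q s hs hpq
  induction p using Fin.lastCases with
  | last =>
    induction q using Fin.lastCases with
    | last => exact absurd rfl hpq
    | cast q => simpa using (key2 s hs q).neg
  | cast p =>
    induction q using Fin.lastCases with
    | last => exact key2 s hs p
    | cast q =>
      have hpq' : p ≠ q := fun h => hpq (by rw [h])
      by_cases hp : p = outermost hn w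
      · subst hp
        exact key1 s hs q hpq'.symm
      by_cases hq : q = outermost hn w
      · subst hq
        simpa using (key1 s hs p hpq').neg
      · have hboth : ∀ q : Fin n, q ≠ outermost hn w →
            g q.castSucc s = strand w q ((w.length + 1) * s) := by
          intro q hq
          rcases le_total (((w.length : ℝ) + 1) * s) w.length with ht | ht
          · exact g_early q s ht
          · exact g_late_ne q hq s hs.2 ht
        rw [hboth p hp, hboth q hq, stabStrand_of_ne hn w hp, stabStrand_of_ne hn w hq]
        exact Or.inl ⟨rfl, sub_ne_zero.2 (strand_ne w hpq' _)⟩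

/-! ### Pulling the loop through the braid axis -/

theorem IsClosedBraid.sub_const {n : ℕ} {π : Equiv.Perm (Fin n)} {z : Fin n → ℝ → ℂ}
    (hz : IsClosedBraid π z) (a : ℂ) : IsClosedBraid π fun p s => z p s - a :=
  ⟨fun p => (hz.smooth p).sub contDiff_const, fun p s => by rw [hz.periodic],
    fun p q s h h' => hz.ne p q s h (sub_left_injective h')⟩

theorem isotopic_sub_const {n : ℕ} {π : Equiv.Perm (Fin n)} {z : Fin n → ℝ → ℂ}
    (hz : IsClosedBraid π z) (a : ℂ) :
    Isotopic (braidLink hz) (braidLink (hz.sub_const a)) := by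
  refine isotopic_of_smooth (smoothIsotopy_of_linear _ _ ?_)
  intro p q s _ hpq τ _ h
  exact sub_ne_zero.2 (hz.ne p q s hpq) (by linear_combination h)

/-- The closed braid `loopStrand hn w` with its loop winding `1 - τ` times around the axis. -/
def loopCone {n : ℕ} (hn : 0 < n) (w : List (Fin (n - 1))) (τ : ℝ) (q : Fin n) (s : ℝ) : ℂ × ℂ :=
  (circ s * if q = outermost hn w then ((1 - τ : ℝ) : ℂ) * circ (spin w.length s) + (τ : ℝ) else 1,
    loopStrand hn w q s - (n - 1 / 2 : ℝ))

/-- The part of the loop that is moved. -/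
def IsActive {n : ℕ} (hn : 0 < n) (w : List (Fin (n - 1))) (q : Fin n) (s : ℝ) : Prop :=
  q = outermost hn w ∧ (w.length : ℝ) + 1 / 3 ≤ (w.length + 1) * s ∧
    ((w.length : ℝ) + 1) * s < w.length + 2 / 3

theorem circ_zero : circ 0 = 1 := by simpa using circ_int 0

theorem circ_one : circ 1 = 1 := by simpa using circ_int 1

theorem loopCone_fst {n : ℕ} (hn : 0 < n) (w : List (Fin (n - 1))) (τ : ℝ) {q : Fin n} {s : ℝ}
    (h : ¬ IsActive hn w q s) : (loopCone hn w τ q s).1 = circ s := by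
  simp only [loopCone]
  split_ifs with hq
  · have hspin : circ (spin w.length s) = 1 := by
      rcases lt_or_ge (((w.length : ℝ) + 1) * s) (w.length + 1 / 3) with h1 | h1
      · rw [spin_eq_zero h1.le, circ_zero]
      rcases lt_or_ge (((w.length : ℝ) + 1) * s) (w.length + 2 / 3) with h2 | h2
      · exact absurd ⟨hq, h1, h2⟩ h
      · rw [spin_eq_one h2, circ_one]
    rw [hspin]
    push_cast
    ring
  · rw [mul_one]

theorem loopCone_snd {n : ℕ} (hn : 0 < n) (w : List (Fin (n - 1))) (τ : ℝ) {q : Fin n} {s : ℝ}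
    (h : IsActive hn w q s) : (loopCone hn w τ q s).2 =
      (1 / 2 : ℝ) + (height w.length (s + spin w.length s) : ℝ) * Complex.I := by
  obtain ⟨rfl, h1, h2⟩ := h
  simp only [loopCone]
  rw [loopStrand_outermost hn w (by linarith), rampUp_eq_one h1, rampDown_eq_one h2.le]
  push_cast
  ring

/-- After the translation, only the loop reaches positive real part. Its moved part lies on the line
of real part 1/2, so a common ray would force the slope im / re to be twice the height there. The
ramp leading into the loop has smaller slopes and the ramp leading out has larger ones. Only second
coordinates enter, hence nothing depends on τ. -/
theorem loopCone_ray {n : ℕ} (hn : 0 < n) {w : List (Fin (n - 1))} (hw : w ≠ []) (τ : ℝ)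
    {q q' : Fin n} {s s' : ℝ} (hs : s < 1) (h : ¬ IsActive hn w q s) (h' : IsActive hn w q' s')
    (hre : 0 < (loopCone hn w τ q s).2.re) :
    (loopCone hn w τ q s).2.im ≠
      2 * (loopCone hn w τ q s).2.re * height w.length (s' + spin w.length s') := by
  have hl : (0 : ℝ) < w.length := by exact_mod_cast List.length_pos_iff.2 hw
  have hmono := spin_monotone hl.le
  have hsp := spin_mem w.length s'
  obtain ⟨_, h1, h2⟩ := h'
  simp only [loopCone] at hre ⊢
  have hq : q = outermost hn w := by
    by_contra hq
    rw [loopStrand_of_ne hn w hq, Complex.sub_re, Complex.ofReal_re] at hre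
    have := strand_re_le w q ((w.length + 1) * s)
    linarith
  subst hq
  have hlate : (w.length : ℝ) < (w.length + 1) * s := by
    by_contra hc
    rw [loopStrand_of_le hn w _ (not_lt.1 hc), Complex.sub_re, Complex.ofReal_re] at hre
    have := strand_re_le w (outermost hn w) ((w.length + 1) * s)
    linarith
  rw [loopStrand_outermost hn w (by linarith)] at hre ⊢
  have hcase : ((w.length : ℝ) + 1) * s < w.length + 1 / 3 ∨
      (w.length : ℝ) + 2 / 3 ≤ (w.length + 1) * s := by
    by_contra hc
    rw [not_or, not_lt, not_le] at hc
    exact h ⟨rfl, hc.1, hc.2⟩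
  have e : ∀ a c v b : ℝ, ((a : ℂ) + (c : ℂ) * (1 + (v : ℂ) * Complex.I) - (b : ℂ)).re =
      a + c - b ∧ ((a : ℂ) + (c : ℂ) * (1 + (v : ℂ) * Complex.I) - (b : ℂ)).im = c * v := by
    intro a c v b
    constructor <;> simp
  rw [(e _ _ _ _).1] at hre
  rw [(e _ _ _ _).1, (e _ _ _ _).2]
  have hu := rampUp_mem w.length s
  have hd := rampDown_mem w.length s
  rcases hcase with hc | hc
  -- With u the ramp, h < 0 the height at s and h' > h the other height, re = u - 1/2 and im = uh,
  -- and uh ≤ (2u - 1)h < (2u - 1)h'. The other case is its mirror image.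
  · rw [rampDown_eq_one (by linarith)] at hre ⊢
    rw [spin_eq_zero hc.le, add_zero, mul_one] at *
    have hneg := height_neg hl hs.le
    have hlt : height w.length s < height w.length (s' + spin w.length s') := by
      have : s < s' := by nlinarith
      unfold height
      linarith [hsp.1]
    apply ne_of_lt
    nlinarith [mul_lt_mul_of_pos_left hlt hre, mul_nonneg (sub_nonneg.2 hu.2) (neg_pos.2 hneg).le]
  · rw [rampUp_eq_one (by linarith)] at hre ⊢
    rw [spin_eq_one hc, one_mul] at *
    have hpos := height_pos hl hlate.le
    have hlt : height w.length (s' + spin w.length s') < height w.length (s + 1) := by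
      have : s' < s := by nlinarith
      unfold height
      linarith [hsp.2]
    apply ne_of_gt
    nlinarith [mul_lt_mul_of_pos_left hlt hre, mul_nonneg (sub_nonneg.2 hd.2) hpos.le]

theorem contDiff_loopCone {n : ℕ} (hn : 0 < n) (w : List (Fin (n - 1))) (q : Fin n) :
    ContDiff ℝ ∞ fun x : ℝ × ℝ => loopCone hn w x.1 q x.2 := by
  have h1 : ContDiff ℝ ∞ fun x : ℝ × ℝ => circ x.2 := contDiff_circ.comp contDiff_snd
  have h2 : ContDiff ℝ ∞ fun x : ℝ × ℝ => circ (spin w.length x.2) :=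
    contDiff_circ.comp ((contDiff_spin _).comp contDiff_snd)
  have h3 : ContDiff ℝ ∞ fun x : ℝ × ℝ => loopStrand hn w q x.2 :=
    (contDiff_loopStrand hn w q).comp contDiff_snd
  have h4 : ContDiff ℝ ∞ fun x : ℝ × ℝ => ((x.1 : ℝ) : ℂ) :=
    Complex.ofRealCLM.contDiff.comp contDiff_fst
  have h5 : ContDiff ℝ ∞ fun x : ℝ × ℝ => ((1 - x.1 : ℝ) : ℂ) :=
    Complex.ofRealCLM.contDiff.comp (contDiff_const.sub contDiff_fst)
  unfold loopCone
  split_ifs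
  · exact (h1.mul ((h5.mul h2).add h4)).prodMk (h3.sub contDiff_const)
  · exact (h1.mul contDiff_const).prodMk (h3.sub contDiff_const)

theorem loopCone_periodic {n : ℕ} (hn : 0 < n) (w : List (Fin (n - 1))) (τ : ℝ) (q : Fin n) (s : ℝ)
    (h1 : -(1 / (6 * ((w.length : ℝ) + 1))) < s) (h2 : s < 0) :
    loopCone hn w τ q (s + 1) = loopCone hn w τ (wordPerm w q) s := by
  have hl : (0 : ℝ) ≤ w.length := Nat.cast_nonneg _
  have h3 := small_time hl h1
  have h4 : ((w.length : ℝ) + 1) * s ≤ 0 := mul_nonpos_of_nonneg_of_nonpos (by linarith) h2.le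
  refine Prod.ext ?_ ?_
  · rw [loopCone_fst hn w τ (fun h => by have := h.2.2; linarith),
      loopCone_fst hn w τ (fun h => by have := h.2.1; linarith), circ_add, circ_one, mul_one]
  · simp only [loopCone]
    rw [loopStrand_periodic hn w q s h1 h2]

theorem contDiff_periodize_loopCone {n : ℕ} (hn : 0 < n) (w : List (Fin (n - 1))) (q : Fin n) :
    ContDiff ℝ ∞ fun x : ℝ × ℝ => periodize (wordPerm w) (loopCone hn w x.1) q x.2 :=
  contDiff_periodize₂ (ε := 1 / (6 * ((w.length : ℝ) + 1))) (by positivity)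
    (contDiff_loopCone hn w) (loopCone_periodic hn w) q

/-- On the moved part the second coordinate has constant real part 1/2 and increasing imaginary
part, so its velocity is not radial. Elsewhere the first coordinate runs along the unit circle.
Because `IsActive` is half-open, each case persists for a short time to the right, which suffices
for one-sided derivatives. -/
theorem loopCone_transverse {n : ℕ} (hn : 0 < n) (w : List (Fin (n - 1))) (τ : ℝ) (q : Fin n)
    {V : ℝ → ℂ × ℂ} {s : ℝ} (hs : s < 1) (hV : DifferentiableAt ℝ V s)
    (heq : ∀ x, s ≤ x → x < 1 → V x = loopCone hn w τ q x) (c : ℝ) : deriv V s ≠ c • V s := by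
  have hl : (0 : ℝ) ≤ w.length := Nat.cast_nonneg _
  have hVs := heq s le_rfl hs
  by_cases ha : IsActive hn w q s
  · intro hd
    have hB : HasDerivWithinAt (fun x => (V x).2) (c • V s).2 (Set.Ici s) s := by
      have := hV.hasDerivAt
      rw [hd] at this
      exact ((ContinuousLinearMap.snd ℝ ℂ ℂ).hasFDerivAt.comp_hasDerivAt s this).hasDerivWithinAt
    set d := deriv (spin w.length) s with hdd
    have hspin : HasDerivAt (spin w.length) d s :=
      ((contDiff_spin _).differentiable (by simp) s).hasDerivAt
    have hd0 : 0 ≤ d := (spin_monotone hl).deriv_nonneg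
    have hh : HasDerivAt (fun x => height w.length (x + spin w.length x)) (1 + d) s :=
      (((hasDerivAt_id s).add hspin).sub_const _).sub_const _
    have hB' : HasDerivWithinAt (fun x => (V x).2) (((1 + d : ℝ) : ℂ) * Complex.I) (Set.Ici s) s := by
      have h1 : HasDerivAt (fun x => ((1 / 2 : ℝ) : ℂ) +
          ((height w.length (x + spin w.length x) : ℝ) : ℂ) * Complex.I)
          (((1 + d : ℝ) : ℂ) * Complex.I) s := (hh.ofReal_comp.mul_const _).const_add _
      refine h1.hasDerivWithinAt.congr_of_eventuallyEq ?_ ?_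
      · have hlt : s < (w.length + 2 / 3) / ((w.length : ℝ) + 1) := by
          rw [lt_div_iff₀ (by positivity)]
          linarith [ha.2.2]
        filter_upwards [Ico_mem_nhdsGE (lt_min hlt hs)] with x hx
        have hx2 := lt_min_iff.1 hx.2
        rw [lt_div_iff₀ (by positivity)] at hx2
        rw [heq x hx.1 hx2.2, loopCone_snd hn w τ]
        refine ⟨ha.1, ?_, by linarith [hx2.1]⟩
        have := mul_le_mul_of_nonneg_left hx.1 (by linarith : 0 ≤ (w.length : ℝ) + 1)
        linarith [ha.2.1]
      · rw [hVs, loopCone_snd hn w τ ha]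
    have h2 := (uniqueDiffWithinAt_Ici s).eq_deriv _ hB hB'
    rw [Prod.smul_snd, hVs, loopCone_snd hn w τ ha, Complex.real_smul] at h2
    have hre := congrArg Complex.re h2
    have him := congrArg Complex.im h2
    simp only [Complex.re_ofReal_mul, Complex.im_ofReal_mul, Complex.add_re, Complex.add_im,
      Complex.ofReal_re, Complex.ofReal_im, Complex.I_re, Complex.I_im, mul_zero, mul_one, add_zero,
      zero_add] at hre him
    have hc : c = 0 := by linarith
    rw [hc] at him
    linarith
  · refine ne_smul_of_hasDerivWithinAt_circ hV ?_ (by rw [hVs, loopCone_fst hn w τ ha]) c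
    refine (hasDerivAt_circ s).hasDerivWithinAt.congr_of_eventuallyEq ?_
      (by rw [hVs, loopCone_fst hn w τ ha])
    rcases lt_or_ge (((w.length : ℝ) + 1) * s) (w.length + 1 / 3) with h | h
    · have hlt : s < (w.length + 1 / 3) / ((w.length : ℝ) + 1) := by
        rw [lt_div_iff₀ (by positivity)]
        linarith
      filter_upwards [Ico_mem_nhdsGE (lt_min hlt hs)] with x hx
      have hx2 := lt_min_iff.1 hx.2
      rw [lt_div_iff₀ (by positivity)] at hx2
      rw [heq x hx.1 hx2.2, loopCone_fst hn w τ]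
      intro h'
      have := h'.2.1
      linarith [hx2.1]
    · filter_upwards [Ico_mem_nhdsGE hs] with x hx
      rw [heq x hx.1 hx.2, loopCone_fst hn w τ]
      intro h'
      have := mul_le_mul_of_nonneg_left hx.1 (by linarith : 0 ≤ (w.length : ℝ) + 1)
      exact ha ⟨h'.1, h, by linarith [h'.2.2]⟩

/-- The first coordinate can vanish only where the loop crosses the braid axis, and there the second
has real part 1/2. -/
theorem loopCone_ne_zero {n : ℕ} (hn : 0 < n) (w : List (Fin (n - 1))) (τ : ℝ) (q : Fin n) (s : ℝ) :
    loopCone hn w τ q s ≠ 0 := by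
  intro h
  by_cases ha : IsActive hn w q s
  · have h2 := congrArg (fun v : ℂ × ℂ => v.2.re) h
    simp only [loopCone_snd hn w τ ha] at h2
    simp at h2
  · have h1 := congrArg Prod.fst h
    rw [loopCone_fst hn w τ ha] at h1
    exact circ_ne_zero s h1

/-- Two moved points have equal real part, so c = 1 and the strictly increasing height separates
them. A moved and an unmoved point are separated by `loopCone_ray`. For two unmoved points the unit
circle forces c = 1 and equal times, and the closed braid `hz` has no collisions. -/
theorem loopCone_inj {n : ℕ} (hn : 0 < n) {w : List (Fin (n - 1))} (hw : w ≠ []) (τ : ℝ)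
    (hz : IsClosedBraid (wordPerm w) (periodize (wordPerm w) (loopStrand hn w)))
    {q q' : Fin n} {s s' c : ℝ} (hs : s ∈ Set.Ico (0 : ℝ) 1) (hs' : s' ∈ Set.Ico (0 : ℝ) 1)
    (hc : 0 < c) (h : loopCone hn w τ q s = c • loopCone hn w τ q' s') : q = q' ∧ s = s' := by
  have hl : (0 : ℝ) ≤ w.length := Nat.cast_nonneg _
  have h1 : (loopCone hn w τ q s).1 = c • (loopCone hn w τ q' s').1 := by rw [h, Prod.smul_fst]
  have h2 : (loopCone hn w τ q s).2 = c • (loopCone hn w τ q' s').2 := by rw [h, Prod.smul_snd]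
  have hre := congrArg Complex.re h2
  have him := congrArg Complex.im h2
  rw [Complex.smul_re, smul_eq_mul] at hre
  rw [Complex.smul_im, smul_eq_mul] at him
  have hval : ∀ x : ℝ, ((1 / 2 : ℝ) + (x : ℂ) * Complex.I : ℂ).re = 1 / 2 ∧
      ((1 / 2 : ℝ) + (x : ℂ) * Complex.I : ℂ).im = x := fun x => by constructor <;> simp
  by_cases ha : IsActive hn w q s <;> by_cases ha' : IsActive hn w q' s'
  · rw [loopCone_snd hn w τ ha, loopCone_snd hn w τ ha', (hval _).1, (hval _).1] at hre
    have hc1 : c = 1 := by linarith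
    rw [loopCone_snd hn w τ ha, loopCone_snd hn w τ ha', (hval _).2, (hval _).2, hc1, one_mul]
      at him
    refine ⟨ha.1.trans ha'.1.symm, ?_⟩
    unfold height at him
    rcases lt_trichotomy s s' with hlt | heq | hlt
    · have := spin_monotone hl hlt.le
      linarith
    · exact heq
    · have := spin_monotone hl hlt.le
      linarith
  · exfalso
    rw [loopCone_snd hn w τ ha, (hval _).1] at hre
    rw [loopCone_snd hn w τ ha, (hval _).2] at him
    have hpos : 0 < (loopCone hn w τ q' s').2.re := by
      by_contra hneg
      nlinarith
    refine loopCone_ray hn hw τ hs'.2 ha' ha hpos ?_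
    rw [him]
    linear_combination (2 * (loopCone hn w τ q' s').2.im) * hre
  · exfalso
    rw [loopCone_snd hn w τ ha', (hval _).1] at hre
    rw [loopCone_snd hn w τ ha', (hval _).2] at him
    refine loopCone_ray hn hw τ hs.2 ha ha' (by rw [hre]; linarith) ?_
    rw [him, hre]
    ring
  · rw [loopCone_fst hn w τ ha, loopCone_fst hn w τ ha'] at h1
    have hc1 : c = 1 := by
      have := congrArg norm h1
      rw [norm_smul, norm_circ, norm_circ, Real.norm_of_nonneg hc.le, mul_one] at this
      exact this.symm
    rw [hc1, one_smul] at h1 h2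
    obtain ⟨k, hk⟩ := circ_eq_iff.1 h1
    have hss : s = s' := by
      have hf := congrArg Int.fract hk
      rw [Int.fract_add_intCast, Int.fract_eq_self.2 hs, Int.fract_eq_self.2 hs'] at hf
      exact hf
    subst hss
    refine ⟨?_, rfl⟩
    by_contra hne
    refine hz.ne q q' s hne ?_
    rw [periodize_of_mem _ _ _ hs, periodize_of_mem _ _ _ hs]
    simp only [loopCone] at h2
    exact sub_left_injective h2

theorem contDiff_periodize_loopCone_apply {n : ℕ} (hn : 0 < n) (w : List (Fin (n - 1))) (τ : ℝ)
    (q : Fin n) : ContDiff ℝ ∞ (periodize (wordPerm w) (loopCone hn w τ) q) :=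
  ContDiff.comp (g := fun x : ℝ × ℝ => periodize (wordPerm w) (loopCone hn w x.1) q x.2)
    (f := fun s : ℝ => (τ, s)) (contDiff_periodize_loopCone hn w q)
    (contDiff_const.prodMk contDiff_id)

theorem deriv_periodize_loopCone_ne {n : ℕ} (hn : 0 < n) (w : List (Fin (n - 1))) (τ : ℝ)
    (q : Fin n) (s c : ℝ) : deriv (periodize (wordPerm w) (loopCone hn w τ) q) s ≠
      c • periodize (wordPerm w) (loopCone hn w τ) q s := by
  set V := periodize (wordPerm w) (loopCone hn w τ) with hV
  have hsm : ∀ q, ContDiff ℝ ∞ (V q) := contDiff_periodize_loopCone_apply hn w τ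
  have h1 : ∀ x, V q (x + ⌊s⌋) = V ((wordPerm w ^ ⌊s⌋) q) x := fun x =>
    add_int_of_add_one (π := wordPerm w) (f := V) (periodize_add_one _ _) _ _ _
  have h2 : deriv (V q) s = deriv (V ((wordPerm w ^ ⌊s⌋) q)) (Int.fract s) := by
    rw [← funext h1, deriv_comp_add_const, Int.fract_add_floor]
  have h3 := h1 (Int.fract s)
  rw [Int.fract_add_floor] at h3
  rw [h2, h3]
  refine loopCone_transverse hn w τ ((wordPerm w ^ ⌊s⌋) q) (Int.fract_lt_one s)
    ((hsm _).differentiable (by simp) _) ?_ c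
  intro x hx hx1
  exact periodize_of_mem _ _ _ ⟨(Int.fract_nonneg s).trans hx, hx1⟩

theorem periodize_loopCone_inj {n : ℕ} (hn : 0 < n) {w : List (Fin (n - 1))} (hw : w ≠ []) (τ : ℝ)
    (hz : IsClosedBraid (wordPerm w) (periodize (wordPerm w) (loopStrand hn w)))
    {i j : Fin n} {s t c : ℝ} (hc : 0 < c) (h : periodize (wordPerm w) (loopCone hn w τ) i s =
      c • periodize (wordPerm w) (loopCone hn w τ) j t) :
    ∃ k : ℤ, s = t + k ∧ (wordPerm w ^ k) i = j := by
  obtain ⟨h1, h2⟩ := loopCone_inj hn hw τ hz ⟨Int.fract_nonneg s, Int.fract_lt_one s⟩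
    ⟨Int.fract_nonneg t, Int.fract_lt_one t⟩ hc h
  refine ⟨⌊s⌋ - ⌊t⌋, ?_, ?_⟩
  · push_cast
    unfold Int.fract at h2
    linarith
  · rw [sub_eq_neg_add, zpow_add, Equiv.Perm.mul_apply, h1, ← Equiv.Perm.mul_apply, ← zpow_add,
      neg_add_cancel, zpow_zero, Equiv.Perm.one_apply]

theorem isConeEmbedded_loopCone {n : ℕ} (hn : 0 < n) {w : List (Fin (n - 1))} (hw : w ≠ []) (τ : ℝ)
    (hz : IsClosedBraid (wordPerm w) (periodize (wordPerm w) (loopStrand hn w))) :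
    IsConeEmbedded (wordPerm w) (periodize (wordPerm w) (loopCone hn w τ)) :=
  ⟨contDiff_periodize_loopCone_apply hn w τ, fun _ _ => loopCone_ne_zero hn w τ _ _,
    deriv_periodize_loopCone_ne hn w τ, periodize_add_one _ _,
    fun _ _ _ _ _ hc h => periodize_loopCone_inj hn hw τ hz hc h⟩

/-! ### Identification of the two ends of the destabilization isotopy -/

/-- The time change between a closed braid and its destabilization. -/
def unwind {n : ℕ} (hn : 0 < n) (w : List (Fin (n - 1))) (q : Fin n) (s : ℝ) : ℝ :=
  if q = outermost hn w then s + spin w.length s else s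

/-- For τ = 0 the circle coordinate of the loop is that of time x = s + spin, so x is the natural
time. It runs over two periods: for x < 1 on the outermost strand of the stabilized braid, for x ≥ 1
on its last strand at time x - 1. -/
theorem loopCone_eq_stab {n : ℕ} (hn : 0 < n) (w : List (Fin (n - 1))) (q : Fin n) {s : ℝ}
    (hs : s ∈ Set.Ico (0 : ℝ) 1) :
    loopCone hn w 0 q s = braidCone (fun p s => periodize (wordPerm (stabWord hn w))
      (stabStrand hn w) p s - (n - 1 / 2 : ℝ)) q.castSucc (unwind hn w q s) := by
  have hl : (0 : ℝ) ≤ w.length := Nat.cast_nonneg _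
  by_cases hq : q = outermost hn w
  · subst hq
    simp only [loopCone, unwind, braidCone, if_true]
    refine Prod.ext (by simp [circ_add]) ?_
    simp only [sub_left_inj]
    have hsp := spin_mem w.length s
    set x := s + spin w.length s with hx
    have hxs : ((w.length : ℝ) + 1) * s ≤ (w.length + 1) * x :=
      mul_le_mul_of_nonneg_left (by linarith [hsp.1]) (by linarith)
    rcases lt_or_ge x 1 with h | h
    · rw [periodize_of_mem _ _ _ ⟨by linarith [hs.1, hsp.1], h⟩]
      have hd : rampDown w.length s = 1 := by
        apply rampDown_eq_one
        by_contra hc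
        rw [hx, spin_eq_one (not_le.1 hc).le] at h
        linarith [hs.1]
      rcases le_total (((w.length : ℝ) + 1) * s) (w.length + 1 / 3) with ht | ht
      · have hx' : x = s := by rw [hx, spin_eq_zero ht, add_zero]
        rw [stabStrand_castSucc, loopStrand, if_pos rfl, if_pos rfl, ← hx, hx', hd, mul_one]
      · rw [stabStrand_outermost hn w (by linarith), loopStrand_outermost hn w (by linarith), ← hx,
          hd, mul_one, rampUp_eq_one ht, rampUp_eq_one (by linarith)]
    · have ht : (w.length : ℝ) + 1 / 3 ≤ (w.length + 1) * s := by
        by_contra hc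
        rw [hx, spin_eq_zero (not_le.1 hc).le] at h
        linarith [hs.2]
      have e : periodize (wordPerm (stabWord hn w)) (stabStrand hn w) (outermost hn w).castSucc x =
          stabStrand hn w (Fin.last n) (x - 1) := by
        have := periodize_add_one (wordPerm (stabWord hn w)) (stabStrand hn w)
          (outermost hn w).castSucc (x - 1)
        rw [sub_add_cancel, wordPerm_stab_outermost] at this
        rw [this]
        exact periodize_of_mem _ _ _ ⟨by linarith, by linarith [hs.2, hsp.2]⟩
      have hd : rampDown w.length (x - 1) = rampDown w.length s := by
        rcases le_total (((w.length : ℝ) + 1) * s) (w.length + 2 / 3) with h3 | h3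
        · have : ((w.length : ℝ) + 1) * (x - 1) ≤ (w.length + 1) * s :=
            mul_le_mul_of_nonneg_left (by linarith [hsp.2]) (by linarith)
          rw [rampDown_eq_one h3, rampDown_eq_one (by linarith)]
        · rw [hx, spin_eq_one h3, add_sub_cancel_right]
      rw [e, stabStrand_last, loopStrand_outermost hn w (by linarith), ← hx, hd, sub_add_cancel,
        rampUp_eq_one ht, one_mul]
  · simp only [loopCone, unwind, braidCone, if_neg hq, mul_one]
    rw [periodize_of_mem _ _ _ hs, stabStrand_of_ne hn w hq, loopStrand_of_ne hn w hq]

theorem exists_unwind_eq {n : ℕ} (hn : 0 < n) (w : List (Fin (n - 1))) {y : ℝ}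
    (hy : y ∈ Set.Ico (0 : ℝ) 2) :
    ∃ s ∈ Set.Ico (0 : ℝ) 1, unwind hn w (outermost hn w) s = y := by
  have hl : (0 : ℝ) ≤ w.length := Nat.cast_nonneg _
  simp only [unwind, if_true]
  have hc : ContinuousOn (fun s => s + spin w.length s) (Set.Icc 0 1) :=
    (continuous_id.add (contDiff_spin _).continuous).continuousOn
  have h0 : spin (w.length : ℝ) 0 = 0 := spin_eq_zero (by linarith)
  have h1 : spin (w.length : ℝ) 1 = 1 := spin_eq_one (by linarith)
  obtain ⟨s, hs, hsy⟩ := intermediate_value_Icc (zero_le_one' ℝ) hc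
    (show y ∈ Set.Icc _ _ by
      simp only [h0, h1]
      exact ⟨by linarith [hy.1], by linarith [hy.2]⟩)
  refine ⟨s, ⟨hs.1, lt_of_le_of_ne hs.2 ?_⟩, hsy⟩
  rintro rfl
  simp only [h1] at hsy
  linarith [hy.2]

theorem exists_hasDerivAt_unwind {n : ℕ} (hn : 0 < n) (w : List (Fin (n - 1))) (q : Fin n) (s : ℝ) :
    ∃ d, 0 < d ∧ HasDerivAt (unwind hn w q) d s := by
  have hl : (0 : ℝ) ≤ w.length := Nat.cast_nonneg _
  by_cases hq : q = outermost hn w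
  · refine ⟨1 + deriv (spin w.length) s, ?_, ?_⟩
    · linarith [(spin_monotone hl).deriv_nonneg (x := s)]
    · have : unwind hn w q = fun s => s + spin w.length s := funext fun s => if_pos hq
      rw [this]
      exact (hasDerivAt_id s).add ((contDiff_spin _).differentiable (by simp) s).hasDerivAt
  · have : unwind hn w q = fun s => s := funext fun s => if_neg hq
    rw [this]
    exact ⟨1, one_pos, hasDerivAt_id s⟩

/-- Markov destabilization. -/
theorem isotopic_closure_destab {n : ℕ} (hn : 0 < n) {w : List (Fin (n - 1))} (hw : w ≠ []) :
    Isotopic (closure (stabWord hn w)) (closure w) := by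
  obtain ⟨hz, hi⟩ := isotopic_closure_loop hn w
  obtain ⟨hZ, hj⟩ := isotopic_closure_stab hn hw
  -- The translation by n - 1/2 puts the moved part of the loop at real part 1/2 and all strands
  -- without the loop at real part at most -1/2.
  refine hj.trans ((isotopic_sub_const hZ (n - 1 / 2 : ℝ)).trans (Isotopic.trans ?_
    (hi.trans (isotopic_sub_const hz (n - 1 / 2 : ℝ))).symm))
  apply isotopic_of_smooth
  refine smoothIsotopy_of_cone
    (V := fun τ => periodize (wordPerm w) (loopCone hn w τ)) (π := wordPerm w)
    (contDiff_periodize_loopCone hn w) (fun τ _ => isConeEmbedded_loopCone hn hw τ hz) ?_ ?_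
  · refine (sameOriented_of_reparam (isConeEmbedded_loopCone hn hw 0 hz).isEmbedded
      (hZ.sub_const (n - 1 / 2 : ℝ)).isConeEmbedded.isEmbedded Fin.castSucc (unwind hn w)
      (fun q s _ => exists_hasDerivAt_unwind hn w q s) ?_ ?_).2
    · intro q s hs
      rw [periodize_of_mem _ _ _ hs, loopCone_eq_stab hn w q hs]
    · have hout : ∀ y ∈ Set.Ico (0 : ℝ) 2, ∃ s, normalize (braidCone (fun p s =>
          periodize (wordPerm (stabWord hn w)) (stabStrand hn w) p s - (n - 1 / 2 : ℝ))
          (outermost hn w).castSucc y) =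
            normalize (periodize (wordPerm w) (loopCone hn w 0) (outermost hn w) s) := by
        intro y hy
        obtain ⟨s, hs, rfl⟩ := exists_unwind_eq hn w hy
        exact ⟨s, by rw [periodize_of_mem _ _ _ hs, loopCone_eq_stab hn w _ hs]⟩
      intro p t ht
      induction p using Fin.lastCases with
      | last =>
        obtain ⟨s, hs⟩ := hout (t + 1) ⟨by linarith [ht.1], by linarith [ht.2]⟩
        refine ⟨outermost hn w, s, ?_⟩
        rw [← hs, (hZ.sub_const (n - 1 / 2 : ℝ)).isConeEmbedded.periodic, wordPerm_stab_outermost]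
      | cast q =>
        by_cases hq : q = outermost hn w
        · subst hq
          obtain ⟨s, hs⟩ := hout t ⟨ht.1, by linarith [ht.2]⟩
          exact ⟨_, s, hs⟩
        · refine ⟨q, t, ?_⟩
          rw [periodize_of_mem _ _ _ ht, loopCone_eq_stab hn w q ht, unwind, if_neg hq]
  · have h1 : (fun i t => normalize (periodize (wordPerm w) (loopCone hn w 1) i t)) =
        fun i t => normalize (braidCone (fun p s =>
          periodize (wordPerm w) (loopStrand hn w) p s - (n - 1 / 2 : ℝ)) i t) := by
      funext i t
      have hc : circ (Int.fract t) = circ t := by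
        refine circ_eq_iff.2 ⟨-⌊t⌋, ?_⟩
        push_cast
        unfold Int.fract
        ring
      simp only [periodize, loopCone, braidCone, hc]
      simp
    rw [h1]
    exact (hz.sub_const (n - 1 / 2 : ℝ)).isConeEmbedded.isEmbedded.sameOriented_refl

/-! ### Rewriting positive words -/

/-- Equality of positive words by the braid relations, without passing through inverses. -/
inductive PosEq {n : ℕ} : List (Fin (n - 1)) → List (Fin (n - 1)) → Prop
  | refl (w) : PosEq w w
  | symm {v w} : PosEq v w → PosEq w v
  | trans {u v w} : PosEq u v → PosEq v w → PosEq u w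
  | comm {i j : Fin (n - 1)} (hij : (i : ℕ) + 2 ≤ j) (x y : List (Fin (n - 1))) :
      PosEq (x ++ [i, j] ++ y) (x ++ [j, i] ++ y)
  | braid {i j : Fin (n - 1)} (hij : (i : ℕ) + 1 = j) (x y : List (Fin (n - 1))) :
      PosEq (x ++ [i, j, i] ++ y) (x ++ [j, i, j] ++ y)

theorem ofWord_append {n : ℕ} (u v : List (Fin (n - 1))) :
    (ofWord (u ++ v) : BraidGroup n) = ofWord u * ofWord v := by
  simp [ofWord]

namespace PosEq

theorem append_left {n : ℕ} {u v : List (Fin (n - 1))} (h : PosEq u v) (x : List (Fin (n - 1))) :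
    PosEq (x ++ u) (x ++ v) := by
  induction h with
  | refl w => exact refl _
  | symm _ ih => exact ih.symm
  | trans _ _ ih1 ih2 => exact ih1.trans ih2
  | comm hij y z => simpa using comm hij (x ++ y) z
  | braid hij y z => simpa using braid hij (x ++ y) z

theorem append_right {n : ℕ} {u v : List (Fin (n - 1))} (h : PosEq u v) (x : List (Fin (n - 1))) :
    PosEq (u ++ x) (v ++ x) := by
  induction h with
  | refl w => exact refl _
  | symm _ ih => exact ih.symm
  | trans _ _ ih1 ih2 => exact ih1.trans ih2
  | comm hij y z => simpa using comm hij y (z ++ x)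
  | braid hij y z => simpa using braid hij y (z ++ x)

theorem ofWord_eq {n : ℕ} {u v : List (Fin (n - 1))} (h : PosEq u v) :
    (ofWord u : BraidGroup n) = ofWord v := by
  induction h with
  | refl w => rfl
  | symm _ ih => exact ih.symm
  | trans _ _ ih1 ih2 => exact ih1.trans ih2
  | @comm i j hij y z =>
    have : (ofWord [i, j] : BraidGroup n) = ofWord [j, i] := by
      have := PresentedGroup.mk_eq_one_iff.2 (Subgroup.subset_normalClosure
        (show _ ∈ braidRels n from Or.inr ⟨i, j, hij, rfl⟩))
      rw [map_mul, map_inv, mul_inv_eq_one, map_mul, map_mul] at this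
      simpa [ofWord, PresentedGroup.of] using this
    simp only [ofWord_append, this]
  | @braid i j hij y z =>
    have : (ofWord [i, j, i] : BraidGroup n) = ofWord [j, i, j] := by
      have := PresentedGroup.mk_eq_one_iff.2 (Subgroup.subset_normalClosure
        (show _ ∈ braidRels n from Or.inl ⟨i, j, hij, rfl⟩))
      rw [map_mul, map_inv, mul_inv_eq_one, map_mul, map_mul, map_mul, map_mul, mul_assoc,
        mul_assoc] at this
      simpa [ofWord, PresentedGroup.of] using this
    simp only [ofWord_append, this]

theorem isotopic {n : ℕ} {u v : List (Fin (n - 1))} (h : PosEq u v) :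
    Isotopic (closure u) (closure v) := by
  induction h with
  | refl w => exact Isotopic.refl _
  | symm _ ih => exact ih.symm
  | trans _ _ ih1 ih2 => exact ih1.trans ih2
  | comm hij y z => exact isotopic_closure_comm hij y z
  | braid hij y z => exact isotopic_closure_braid hij y z

theorem slide {n : ℕ} {u : List (Fin (n - 1))} {i j : Fin (n - 1)} (h : PosEq (u ++ [i]) (j :: u))
    (k : ℕ) : PosEq (u ++ List.replicate k i) (List.replicate k j ++ u) := by
  induction k with
  | zero => simpa using refl u
  | succ k ih =>
    rw [List.replicate_succ', List.replicate_succ', ← List.append_assoc]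
    refine (ih.append_right _).trans ?_
    simpa using h.append_left (List.replicate k j)

end PosEq

theorem flatten_replicate_append {α : Type*} (x y : List α) (k : ℕ) :
    (List.replicate (k + 1) (x ++ y)).flatten =
      x ++ (List.replicate k (y ++ x)).flatten ++ y := by
  induction k with
  | zero => simp
  | succ k ih => rw [List.replicate_succ, List.flatten_cons, ih]; simp [List.replicate_succ]

theorem isotopic_closure_rotate_replicate {n : ℕ} (x y : List (Fin (n - 1))) (k : ℕ) :
    Isotopic (closure (List.replicate k (x ++ y)).flatten)
      (closure (List.replicate k (y ++ x)).flatten) := by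
  cases k with
  | zero => simpa using Isotopic.refl _
  | succ k =>
    rw [flatten_replicate_append, List.replicate_succ, List.flatten_cons, List.append_assoc]
    refine (isotopic_closure_rotate _ _).trans ?_
    have : (List.replicate k (y ++ x)).flatten ++ (y ++ x) =
        (y ++ x) ++ (List.replicate k (y ++ x)).flatten := by
      have h1 : (List.replicate k (y ++ x)).flatten ++ (y ++ x) =
        (List.replicate (k + 1) (y ++ x)).flatten := by
        rw [List.replicate_succ', List.flatten_append]; simp
      rw [h1, List.replicate_succ, List.flatten_cons]
    rw [List.append_assoc, this]
    exact Isotopic.refl _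

theorem PosEq.replicate {n : ℕ} {u v : List (Fin (n - 1))} (h : PosEq u v) (k : ℕ) :
    PosEq (List.replicate k u).flatten (List.replicate k v).flatten := by
  induction k with
  | zero => exact refl _
  | succ k ih =>
    rw [List.replicate_succ, List.replicate_succ, List.flatten_cons, List.flatten_cons]
    exact (h.append_right _).trans (ih.append_left _)

/-! ### Closures of some 4-braids -/

/-- The word a₁a₃a₂ equals a₃·a₁a₂, a cyclic shift of a₁a₂a₃. It is preferred because its square is
a half twist in a form symmetric in the outer generators. -/
theorem isotopic_torusLink_four (m : ℕ) :
    Isotopic (closure (n := 4) (List.replicate m [0, 2, 1]).flatten) (torusLink 4 m) := by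
  have h : PosEq (n := 4) [0, 2, 1] [2, 0, 1] := .comm (i := 0) (j := 2) (by decide) [] [1]
  exact (h.replicate m).isotopic.trans (isotopic_closure_rotate_replicate [2] [0, 1] m)

theorem torusWord_two (n : ℕ) : torusWord 2 n = List.replicate n 0 := by
  have : List.finRange (2 - 1) = [0] := rfl
  rw [torusWord, this]
  simp

theorem isotopic_torusLink_two_one : Isotopic (closure (n := 4) [0, 2, 1]) (torusLink 2 1) := by
  have h : PosEq (n := 4) [0, 2, 1] [2, 0, 1] := .comm (i := 0) (j := 2) (by decide) [] [1]
  refine h.isotopic.trans ((isotopic_closure_rotate [2] [0, 1]).trans ?_)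
  refine (isotopic_closure_destab (n := 3) (by decide) (w := [0, 1]) (by decide)).trans ?_
  exact isotopic_closure_destab (n := 2) (by decide) (w := [0]) (by decide)

theorem liftWord_replicate {n : ℕ} (k : ℕ) (i : Fin (n - 1)) :
    liftWord (List.replicate k i) = List.replicate k ⟨i, by omega⟩ := by
  simp [liftWord]

/-- Up to rotation this is a₂a₁a₂·a₁^s = a₁a₂a₁·a₁^s, and a further rotation gives a₁^(s+2)·a₂,
which destabilizes. -/
theorem isotopic_torusLink_two_of_three (s : ℕ) :
    Isotopic (closure (n := 3) ([0, 1] ++ List.replicate s 0 ++ [1])) (torusLink 2 (s + 2)) := by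
  refine (isotopic_closure_rotate _ _).trans ?_
  have h1 : PosEq (n := 3) [1, 0, 1] [0, 1, 0] := (PosEq.braid (i := 0) (j := 1) rfl [] []).symm
  refine (h1.append_right (List.replicate s 0)).isotopic.trans ?_
  refine (isotopic_closure_rotate (n := 3) [0, 1] (0 :: List.replicate s 0)).trans ?_
  have h2 := isotopic_closure_destab (n := 2) (by decide) (w := List.replicate (s + 2) 0)
    (by simp [List.replicate_succ])
  rw [← torusWord_two] at h2
  convert h2 using 2
  rw [torusWord_two, stabWord, liftWord_replicate, List.replicate_succ', List.replicate_succ]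
  simp
  rfl

/-- The word a₂a₁a₃a₂ passes the left pair of strands across the right pair, so a crossing within
one pair slides through and becomes a crossing at the other place. -/
theorem posEq_middle_outer : PosEq (n := 4) ([1, 0, 2, 1] ++ [0]) (2 :: [1, 0, 2, 1]) :=
  ((((PosEq.comm (i := 0) (j := 2) (by decide) [2, 1] [1]).trans
    (.symm (.braid (i := 1) (j := 2) rfl [] [0, 1]))).trans
    (.symm (.braid (i := 0) (j := 1) rfl [1, 2] []))).trans
    (.symm (.comm (i := 0) (j := 2) (by decide) [1] [1, 0]))).symm

/-- The powers of a₃ are rotated to the front and slid through the middle word, where they become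
powers of a₁. Then a₃ occurs only once and is removed by destabilization. -/
theorem isotopic_torusLink_two (p q : ℕ) :
    Isotopic (closure (n := 4) ([1, 0, 2, 1] ++ List.replicate p 0 ++ List.replicate q 2))
      (torusLink 2 (p + q + 2)) := by
  refine (isotopic_closure_rotate _ _).trans ?_
  rw [add_comm p q, ← List.append_assoc]
  refine ((posEq_middle_outer.slide q).symm.append_right _).isotopic.trans ?_
  rw [List.append_assoc, List.replicate_append_replicate]
  generalize q + p = s
  have h : PosEq (n := 4) [1, 0, 2, 1] [1, 2, 0, 1] := .comm (i := 0) (j := 2) (by decide) [1] [1]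
  refine (h.append_right _).isotopic.trans ?_
  refine (isotopic_closure_rotate (n := 4) [1] ([2, 0, 1] ++ List.replicate s 0)).trans ?_
  refine (isotopic_closure_rotate (n := 4) [2] ([0, 1] ++ List.replicate s 0 ++ [1])).trans ?_
  have h2 := isotopic_closure_destab (n := 3) (by decide)
    (w := [0, 1] ++ List.replicate s 0 ++ [1]) (by simp)
  refine Isotopic.trans ?_ (h2.trans (isotopic_torusLink_two_of_three s))
  have h3 : stabWord (n := 3) (by decide) ([0, 1] ++ List.replicate s 0 ++ [1]) =
      [0, 1] ++ List.replicate s 0 ++ [1] ++ [2] := by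
    simp [stabWord, liftWord]
  rw [h3]
  exact Isotopic.refl _

/-! ### Successive deletion of generators -/

namespace IsPositive

theorem ofWord {n : ℕ} (w : List (Fin (n - 1))) : IsPositive (ofWord w : BraidGroup n) := ⟨w, rfl⟩

theorem mul {n : ℕ} {x y : BraidGroup n} (hx : IsPositive x) (hy : IsPositive y) :
    IsPositive (x * y) := by
  obtain ⟨u, rfl⟩ := hx
  obtain ⟨v, rfl⟩ := hy
  exact ⟨u ++ v, ofWord_append u v⟩

theorem pow {n : ℕ} {x : BraidGroup n} (hx : IsPositive x) (k : ℕ) : IsPositive (x ^ k) := by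
  induction k with
  | zero => exact ⟨[], by simp [BraidLink.ofWord]⟩
  | succ k ih => exact pow_succ x k ▸ ih.mul hx

end IsPositive

/-- `β'` is obtained from `β` by successively deleting generators. -/
abbrev Reduces {n : ℕ} : BraidGroup n → BraidGroup n → Prop := Relation.ReflTransGen DeletesTo

namespace Reduces

theorem mul_left {n : ℕ} {x β β' : BraidGroup n} (h : Reduces β β') (hx : IsPositive x) :
    Reduces (x * β) (x * β') := by
  obtain ⟨w, rfl⟩ := hx
  refine Relation.ReflTransGen.lift (ofWord w * ·) ?_ _ _ h
  rintro _ _ ⟨u, i, v, rfl, rfl⟩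
  exact ⟨w ++ u, i, v, by rw [List.append_assoc, ofWord_append w],
    by rw [List.append_assoc, ofWord_append w]⟩

theorem mul_right {n : ℕ} {x β β' : BraidGroup n} (h : Reduces β β') (hx : IsPositive x) :
    Reduces (β * x) (β' * x) := by
  obtain ⟨w, rfl⟩ := hx
  refine Relation.ReflTransGen.lift (· * ofWord w) ?_ _ _ h
  rintro _ _ ⟨u, i, v, rfl, rfl⟩
  exact ⟨u, i, v ++ w, by
    rw [← List.cons_append, ← List.append_assoc, ofWord_append _ w],
    by rw [← List.append_assoc, ofWord_append _ w]⟩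

theorem one {n : ℕ} {x : BraidGroup n} (hx : IsPositive x) : Reduces x 1 := by
  obtain ⟨w, rfl⟩ := hx
  induction w with
  | nil => exact .refl
  | cons i w ih => exact .head ⟨[], i, w, rfl, rfl⟩ ih

theorem pow {n : ℕ} {x : BraidGroup n} (hx : IsPositive x) {k l : ℕ} (h : k ≤ l) :
    Reduces (x ^ l) (x ^ k) := by
  obtain ⟨d, rfl⟩ := Nat.exists_eq_add_of_le h
  simpa [pow_add] using (one (hx.pow d)).mul_left (hx.pow k)

end Reduces

/-! ### Deletions in the four-strand braid group -/

local notation "a₁" => (ofWord (n := 4) [0])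
local notation "a₂" => (ofWord (n := 4) [1])
local notation "a₃" => (ofWord (n := 4) [2])

/-- The half twist on four strands. -/
local notation "Δ" => (a₁ * a₃ * a₂ * (a₁ * a₃ * a₂))

theorem outer_commute : Commute a₁ a₃ := by
  have h : PosEq (n := 4) [0, 2] [2, 0] := .comm (i := 0) (j := 2) (by decide) [] []
  simpa [Commute, SemiconjBy, ← ofWord_append] using h.ofWord_eq

/-! ### Explicit identities for the half twist on four strands -/

theorem posEq_halfTwist_first : PosEq (n := 4) [0, 2, 1, 0, 2, 1, 0]
    [2, 0, 2, 1, 0, 2, 1] :=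
  .trans (.comm (i := 0) (j := 2) (by decide) [] [1, 0, 2, 1, 0]) <|
  .trans (.comm (i := 0) (j := 2) (by decide) [2, 0, 1] [1, 0]) <|
  .trans (.braid (i := 0) (j := 1) rfl [2, 0, 1, 2] []) <|
  .trans (.braid (i := 1) (j := 2) rfl [2, 0] [0, 1]) <|
  .symm (.comm (i := 0) (j := 2) (by decide) [2, 0, 2, 1] [1])

theorem posEq_halfTwist_third : PosEq (n := 4) [0, 2, 1, 0, 2, 1, 2]
    [0, 0, 2, 1, 0, 2, 1] :=
  .trans (.symm (.braid (i := 1) (j := 2) rfl [0, 2, 1, 0] [])) <|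
  .trans (.symm (.braid (i := 0) (j := 1) rfl [0, 2] [2, 1])) <|
  .symm (.comm (i := 0) (j := 2) (by decide) [0] [1, 0, 2, 1])

theorem posEq_halfTwist : PosEq (n := 4) [0, 2, 1, 0, 2, 1]
    [1, 0, 2, 1, 2, 0] :=
  .trans (.comm (i := 0) (j := 2) (by decide) [0, 2, 1] [1]) <|
  .trans (.symm (.braid (i := 1) (j := 2) rfl [0] [0, 1])) <|
  .trans (.symm (.braid (i := 0) (j := 1) rfl [0, 1, 2] [])) <|
  .trans (.symm (.comm (i := 0) (j := 2) (by decide) [0, 1] [1, 0])) <|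
  .trans (.braid (i := 0) (j := 1) rfl [] [2, 1, 0]) <|
  .braid (i := 1) (j := 2) rfl [1, 0] [0]

/-- The target is chosen for its last a₃: without it, a run of four letters a₂ follows a₃a₃a₂a₁, and
`posEq_collect` applies. -/
theorem posEq_halfTwist_mul : PosEq (n := 4) [0, 2, 1, 0, 2, 1, 0, 2, 1]
    [2, 2, 1, 0, 1, 1, 2, 1, 1] :=
  .trans (.comm (i := 0) (j := 2) (by decide) [] [1, 0, 2, 1, 0, 2, 1]) <|
  .trans (.comm (i := 0) (j := 2) (by decide) [2, 0, 1] [1, 0, 2, 1]) <|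
  .trans (.braid (i := 0) (j := 1) rfl [2, 0, 1, 2] [2, 1]) <|
  .trans (.braid (i := 1) (j := 2) rfl [2, 0] [0, 1, 2, 1]) <|
  .trans (.comm (i := 0) (j := 2) (by decide) [2] [1, 2, 0, 1, 2, 1]) <|
  .trans (.symm (.comm (i := 0) (j := 2) (by decide) [2, 2, 0, 1] [1, 2, 1])) <|
  .trans (.braid (i := 0) (j := 1) rfl [2, 2] [2, 1, 2, 1]) <|
  .symm (.braid (i := 1) (j := 2) rfl [2, 2, 1, 0, 1] [1])

/-- Each use of a₂a₁a₂ = a₁a₂a₁ converts one trailing a₂ into an a₁ that commutes past a₃a₃ to the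
front; this is done four times. -/
theorem posEq_collect : PosEq (n := 4) [2, 2, 1, 0, 1, 1, 1, 1]
    [0, 0, 0, 0, 2, 2, 1, 0] :=
  .trans (.symm (.braid (i := 0) (j := 1) rfl [2, 2] [1, 1, 1])) <|
  .trans (.symm (.comm (i := 0) (j := 2) (by decide) [2] [1, 0, 1, 1, 1])) <|
  .trans (.symm (.comm (i := 0) (j := 2) (by decide) [] [2, 1, 0, 1, 1, 1])) <|
  .trans (.symm (.braid (i := 0) (j := 1) rfl [0, 2, 2] [1, 1])) <|
  .trans (.symm (.comm (i := 0) (j := 2) (by decide) [0, 2] [1, 0, 1, 1])) <|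
  .trans (.symm (.comm (i := 0) (j := 2) (by decide) [0] [2, 1, 0, 1, 1])) <|
  .trans (.symm (.braid (i := 0) (j := 1) rfl [0, 0, 2, 2] [1])) <|
  .trans (.symm (.comm (i := 0) (j := 2) (by decide) [0, 0, 2] [1, 0, 1])) <|
  .trans (.symm (.comm (i := 0) (j := 2) (by decide) [0, 0] [2, 1, 0, 1])) <|
  .trans (.symm (.braid (i := 0) (j := 1) rfl [0, 0, 0, 2, 2] [])) <|
  .trans (.symm (.comm (i := 0) (j := 2) (by decide) [0, 0, 0, 2] [1, 0])) <|
  .symm (.comm (i := 0) (j := 2) (by decide) [0, 0, 0] [2, 1, 0])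

theorem isPositive_halfTwist : IsPositive Δ := by
  have h : IsPositive (a₁ * a₃ * a₂) := ((IsPositive.ofWord [0]).mul (.ofWord [2])).mul (.ofWord [1])
  exact h.mul h

theorem halfTwist_mul_first : SemiconjBy Δ a₁ a₃ := by
  simpa [SemiconjBy, ← ofWord_append] using posEq_halfTwist_first.ofWord_eq

theorem halfTwist_mul_third : SemiconjBy Δ a₃ a₁ := by
  simpa [SemiconjBy, ← ofWord_append] using posEq_halfTwist_third.ofWord_eq

theorem halfTwist_eq : Δ = a₂ * a₁ * a₃ * a₂ * a₃ * a₁ := by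
  simpa [← ofWord_append] using posEq_halfTwist.ofWord_eq

/-! ### The deletion scheme -/

theorem reduces_halfTwist_mul : Reduces (Δ * (a₁ * a₃ * a₂)) (a₁ ^ 4 * a₃ ^ 2 * a₂ * a₁) := by
  have h1 : Δ * (a₁ * a₃ * a₂) = ofWord ([2, 2, 1, 0, 1, 1] ++ 2 :: [1, 1]) := by
    simpa [← ofWord_append] using posEq_halfTwist_mul.ofWord_eq
  have h2 : a₁ ^ 4 * a₃ ^ 2 * a₂ * a₁ = ofWord ([2, 2, 1, 0, 1, 1] ++ [1, 1]) := by
    simpa [← ofWord_append, pow_succ] using posEq_collect.ofWord_eq.symm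
  exact .single ⟨_, _, _, h1, h2⟩

/-- One a₁ and one a₃ are reserved to form a₁a₃a₂. The remaining outer letters pass through Δ,
exchanging a₁ and a₃, and the basic deletion is applied to Δa₁a₃a₂. -/
theorem reduces_halfTwist_mul_pow (i j t : ℕ) :
    Reduces (Δ * (a₁ ^ (i + 1) * a₃ ^ (j + 1) * a₂ * a₁ ^ t))
      (a₁ ^ (j + 4) * a₃ ^ (i + 2) * a₂ * a₁ ^ (t + 1)) := by
  have h := ((reduces_halfTwist_mul.mul_left (((IsPositive.ofWord [2]).pow i).mul
    ((IsPositive.ofWord [0]).pow j))).mul_right ((IsPositive.ofWord [0]).pow t))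
  convert h using 1
  · have e1 : a₁ ^ (i + 1) * a₃ ^ (j + 1) = a₁ ^ i * a₃ ^ j * (a₁ * a₃) := by
      rw [pow_succ, pow_succ, mul_assoc, ← mul_assoc a₁, (outer_commute.pow_right j).eq]
      simp only [mul_assoc]
    rw [e1]
    calc _ = Δ * a₁ ^ i * a₃ ^ j * (a₁ * a₃ * a₂) * a₁ ^ t := by simp only [mul_assoc]
      _ = _ := by
        rw [(halfTwist_mul_first.pow_right i).eq, mul_assoc (a₃ ^ i) Δ,
          (halfTwist_mul_third.pow_right j).eq]
        simp only [mul_assoc]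
  · have e1 : a₃ ^ i * a₁ ^ j * a₁ ^ 4 * a₃ ^ 2 = a₁ ^ (j + 4) * a₃ ^ (i + 2) := by
      rw [mul_assoc (a₃ ^ i), ← pow_add, ← (outer_commute.pow_pow _ _).eq, mul_assoc, ← pow_add]
    rw [← e1, pow_succ' _ t]
    simp only [mul_assoc]

/-- Each further Δ costs one deletion and contributes five outer letters: four in front of the
single a₂ and one behind it. -/
theorem exists_reduces_odd (t : ℕ) : ∃ i j, i + j = 4 * t ∧
    Reduces ((a₁ * a₃ * a₂) ^ (2 * t + 1)) (a₁ ^ (i + 1) * a₃ ^ (j + 1) * a₂ * a₁ ^ t) := by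
  induction t with
  | zero => exact ⟨0, 0, rfl, by simpa using Relation.ReflTransGen.refl⟩
  | succ t ih =>
    obtain ⟨i, j, hij, h⟩ := ih
    -- The exponents are exchanged by conjugation with Δ.
    refine ⟨j + 3, i + 1, by omega, ?_⟩
    have h1 := h.mul_left isPositive_halfTwist
    rw [← pow_two, ← pow_add, add_comm, pow_two] at h1
    exact h1.trans (reduces_halfTwist_mul_pow i j t)

theorem halfTwist_mul_pow (p q : ℕ) : Δ * (a₁ ^ p * a₃ ^ q) =
    a₂ * a₁ * a₃ * a₂ * a₁ ^ (p + 1) * a₃ ^ (q + 1) := by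
  rw [halfTwist_eq, pow_succ', pow_succ', mul_assoc _ a₃ a₁, ← outer_commute.eq]
  simp only [mul_assoc]
  rw [← mul_assoc a₃ (a₁ ^ p), ← (outer_commute.pow_left p).eq]
  simp only [mul_assoc]

/-- Deleting the only a₂ merges the outer powers to a total of (4t + 2) + t. The last Δ is left
intact, since it supplies the middle word for the closure. -/
theorem reduces_halfTwist_odd (t : ℕ) : ∃ p q, p + q = 5 * t + 2 ∧
    Reduces ((a₁ * a₃ * a₂) ^ (2 * t + 3)) (Δ * (a₁ ^ p * a₃ ^ q)) := by
  obtain ⟨i, j, hij, h⟩ := exists_reduces_odd t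
  refine ⟨i + 1 + t, j + 1, by omega, ?_⟩
  have h1 := h.trans (((Reduces.one (IsPositive.ofWord [1])).mul_left
    (((IsPositive.ofWord [0]).pow (i + 1)).mul ((IsPositive.ofWord [2]).pow (j + 1)))).mul_right
      ((IsPositive.ofWord [0]).pow t))
  rw [mul_one, mul_assoc (a₁ ^ (i + 1)), ← (outer_commute.pow_pow _ _).eq, ← mul_assoc,
    ← pow_add] at h1
  have h2 := Reduces.mul_left h1 isPositive_halfTwist
  rw [← pow_two, ← pow_add, add_comm, pow_two] at h2
  exact h2

/-- The additional factor a₁a₃a₂ loses its a₂ and contributes one a₁ and one a₃. -/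
theorem reduces_halfTwist_even (t : ℕ) : ∃ p q, p + q = 5 * t + 4 ∧
    Reduces ((a₁ * a₃ * a₂) ^ (2 * t + 4)) (Δ * (a₁ ^ p * a₃ ^ q)) := by
  obtain ⟨p, q, hpq, h⟩ := reduces_halfTwist_odd t
  refine ⟨p + 1, q + 1, by omega, ?_⟩
  have h1 := h.mul_right (((IsPositive.ofWord [0]).mul (.ofWord [2])).mul (.ofWord [1]))
  rw [← pow_succ, ← mul_assoc _ (a₁ * a₃)] at h1
  have h2 := h1.trans ((Reduces.one (IsPositive.ofWord [1])).mul_left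
    ((isPositive_halfTwist.mul (((IsPositive.ofWord [0]).pow p).mul
      ((IsPositive.ofWord [2]).pow q))).mul ((IsPositive.ofWord [0]).mul (.ofWord [2]))))
  convert h2 using 1
  rw [mul_one, mul_assoc Δ, pow_succ, pow_succ, mul_assoc (a₁ ^ p) (a₃ ^ q), ← mul_assoc (a₃ ^ q),
    ← (outer_commute.pow_right q).eq]
  simp only [mul_assoc]

theorem exists_reduces {m n : ℕ} (hm : 2 ≤ m) (h : 2 * n + 3 ≤ 5 * m) : ∃ p q, n ≤ p + q + 2 ∧
    Reduces ((a₁ * a₃ * a₂) ^ m) (a₂ * a₁ * a₃ * a₂ * a₁ ^ p * a₃ ^ q) := by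
  suffices h : ∃ p q, n ≤ p + q + 4 ∧ Reduces ((a₁ * a₃ * a₂) ^ m) (Δ * (a₁ ^ p * a₃ ^ q)) by
    obtain ⟨p, q, hpq, h⟩ := h
    exact ⟨p + 1, q + 1, by omega, halfTwist_mul_pow p q ▸ h⟩
  -- For m = 2 the power is Δ itself, which suffices since then n ≤ 3.
  obtain rfl | hm := hm.eq_or_lt
  · exact ⟨0, 0, by omega, by rw [pow_two, pow_zero, pow_zero, mul_one, mul_one]⟩
  obtain ⟨t, rfl | rfl⟩ : ∃ t, m = 2 * t + 3 ∨ m = 2 * t + 4 := ⟨(m - 3) / 2, by omega⟩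
  · obtain ⟨p, q, hpq, h⟩ := reduces_halfTwist_odd t
    exact ⟨p, q, by omega, h⟩
  · obtain ⟨p, q, hpq, h⟩ := reduces_halfTwist_even t
    exact ⟨p, q, by omega, h⟩

/-! ### Adjusting the number of crossings -/

theorem ofWord_replicate {n : ℕ} (i : Fin (n - 1)) (k : ℕ) :
    (ofWord (List.replicate k i) : BraidGroup n) = ofWord [i] ^ k := by
  simp [ofWord]

theorem ofWord_flatten_replicate {n : ℕ} (w : List (Fin (n - 1))) (k : ℕ) :
    (ofWord (List.replicate k w).flatten : BraidGroup n) = ofWord w ^ k := by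
  induction k with
  | zero => simp [ofWord]
  | succ k ih => rw [List.replicate_succ, List.flatten_cons, ofWord_append, ih, pow_succ']

theorem exists_reduces_isClosure {m n : ℕ} (hn : 0 < n) (h : 2 * n + 3 ≤ 5 * m) :
    ∃ β, IsPositive β ∧ IsClosure β (torusLink 2 n) ∧ Reduces ((a₁ * a₃ * a₂) ^ m) β := by
  have e : a₁ * a₃ * a₂ = ofWord [0, 2, 1] := by simp [← ofWord_append]
  -- The family a₂a₁a₃a₂a₁^p a₃^q starts only at T_{2,2}. For n = 1 a single factor a₁a₃a₂ is kept,
  -- whose closure is the unknot.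
  obtain rfl | hn := (Nat.succ_le_of_lt hn).eq_or_lt
  · refine ⟨_, .ofWord [0, 2, 1], ⟨_, rfl, isotopic_torusLink_two_one⟩, ?_⟩
    simpa [e] using Reduces.pow (IsPositive.ofWord (n := 4) [0, 2, 1]) (show 1 ≤ m by omega)
  obtain ⟨p, q, hpq, h1⟩ := exists_reduces (m := m) (by omega) h
  -- Surplus outer letters are deleted until exactly n - 2 remain.
  obtain ⟨p', q', hp, hq, rfl⟩ : ∃ p' q', p' ≤ p ∧ q' ≤ q ∧ p' + q' + 2 = n :=
    ⟨min p (n - 2), n - 2 - min p (n - 2), by omega, by omega, by omega⟩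
  refine ⟨_, .ofWord _, ⟨_, rfl, isotopic_torusLink_two p' q'⟩, ?_⟩
  have hW : a₂ * a₁ * a₃ * a₂ = ofWord [1, 0, 2, 1] := by simp [← ofWord_append]
  rw [ofWord_append, ofWord_append, ofWord_replicate, ofWord_replicate, ← hW]
  have hW' : IsPositive (a₂ * a₁ * a₃ * a₂) := hW ▸ .ofWord _
  refine h1.trans (((Reduces.pow (.ofWord _) hp).mul_left hW').mul_right
    ((IsPositive.ofWord _).pow q) |>.trans ?_)
  exact (Reduces.pow (.ofWord _) hq).mul_left (hW'.mul ((IsPositive.ofWord _).pow p'))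

end BraidLink

end

theorem proposition5p5 (n m : ℕ) (hn : 0 < n) (hm : 0 < m)
    (h : (n : ℝ) ≤ (5 * (m : ℝ) - 3) / 2) :
    BraidLink.SubwordAdjacent (BraidLink.torusLink 2 n) (BraidLink.torusLink 4 m) := by
  have h' : 2 * n + 3 ≤ 5 * m := by
    have : 2 * (n : ℝ) + 3 ≤ 5 * m := by linarith
    exact_mod_cast this
  obtain ⟨β, hβ, hc, hr⟩ := BraidLink.exists_reduces_isClosure hn h'
  refine ⟨4, by decide, β, BraidLink.ofWord (List.replicate m [0, 2, 1]).flatten, hβ,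
    .ofWord _, hc, ⟨_, rfl, BraidLink.isotopic_torusLink_four m⟩, ?_⟩
  rw [BraidLink.ofWord_flatten_replicate]
  convert hr using 2
  simp [← BraidLink.ofWord_append]
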